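/- Let $\Omega\subset\mathbb R^3$ be open and let $u\in BV(\Omega)$ be continuous on $\Omega$, i.e. $u\in L^1(\Omega)$ is continuous and its distributional partial derivatives $D_1u,D_2u,D_3u$ are finite signed Radon measures on $\Omega$. Put $h(x)=(x_1,x_2,u(x))$ for $x\in\Omega$. Let $U\subset\subset\Omega$ be open (that is, $\overline U$ is compact and contained in $\Omega$) with $|h(\partial U)|=0$, where $|\cdot|$ is the Lebesgue measure on $\mathbb R^3$. For $z\in\mathbb R^3\setminus h(\partial U)$ let $\deg(h,U,z)$ be the topological (Brouwer) degree of $h$ on $U$ at $z$: for a smooth map $g$ having $z\notin g(\partial U)$ as a regular value, $\deg(g,U,z)=\sum_{x\in U\cap g^{-1}\{z\}}\operatorname{sgn}J_g(x)$, and $\deg(h,U,z)=\deg(g,U,z)$ for any such $g$ with $|h-g|<\operatorname{dist}(z,h(\partial U))$ on $\overline U$. Then $\deg(h,U,\cdot)$, which is defined almost everywhere, is integrable on $\mathbb R^3$ and $$\int_{\mathbb R^3}\deg(h,U,z)\,dz=D_3u(U).$$ -/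

import Mathlib

open MeasureTheory Set
open scoped ContDiff

/-! ### Functions of bounded variation on an open set of `ℝⁿ` -/

/-- The finite signed Borel measure `μ` represents on the open set `Ω` the distributional partial
derivative `D_i u`:  `∫_Ω u ∂_i φ dx = - ∫_Ω φ dμ` for all `φ ∈ C_c^∞(Ω)`. (The set function `μ` is
defined on all Borel subsets of `ℝⁿ`, but only its restriction to `Ω` is constrained.) -/
def IsDistribPartial {n : ℕ} (Ω : Set (EuclideanSpace ℝ (Fin n)))
    (u : EuclideanSpace ℝ (Fin n) → ℝ) (i : Fin n)
    (μ : SignedMeasure (EuclideanSpace ℝ (Fin n))) : Prop :=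
  ∀ φ : EuclideanSpace ℝ (Fin n) → ℝ,
    ContDiff ℝ ∞ φ → HasCompactSupport φ → tsupport φ ⊆ Ω →
      ∫ x in Ω, u x * fderiv ℝ φ x (EuclideanSpace.single i 1) = - ∫ᵛ x, φ x ∂<•μ

/-- `u ∈ BV(Ω)`: `u` is integrable on `Ω` and each of its distributional partial derivatives is a
finite signed Radon measure. -/
structure MemBV {n : ℕ} (Ω : Set (EuclideanSpace ℝ (Fin n)))
    (u : EuclideanSpace ℝ (Fin n) → ℝ) : Prop where
  integrableOn : IntegrableOn u Ω volume
  exists_partial : ∀ i : Fin n, ∃ μ : SignedMeasure (EuclideanSpace ℝ (Fin n)),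
    IsDistribPartial Ω u i μ

open Classical in
/-- The signed measure `D_i u` on `Ω`, as a measure on `ℝⁿ` that vanishes off `Ω`
(and `0` if the distributional derivative is not a finite signed measure). -/
noncomputable def bvPartial {n : ℕ} (Ω : Set (EuclideanSpace ℝ (Fin n)))
    (u : EuclideanSpace ℝ (Fin n) → ℝ) (i : Fin n) :
    SignedMeasure (EuclideanSpace ℝ (Fin n)) :=
  if h : ∃ μ : SignedMeasure (EuclideanSpace ℝ (Fin n)), IsDistribPartial Ω u i μ then
    h.choose.restrict Ω
  else 0

/-! ### The topological (Brouwer) degree -/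

/-- `y` is a regular value of `g` on `U`: `J_g(x) ≠ 0` at every `x ∈ U` with `g x = y`. -/
def IsRegularValueOn {n : ℕ} (g : EuclideanSpace ℝ (Fin n) → EuclideanSpace ℝ (Fin n))
    (U : Set (EuclideanSpace ℝ (Fin n))) (y : EuclideanSpace ℝ (Fin n)) : Prop :=
  ∀ x ∈ U, g x = y → (fderiv ℝ g x).det ≠ 0

/-- The degree of a smooth map at a regular value `y ∉ g(∂U)`: the (finite) sum of the signs
of the Jacobian `J_g(x)` over `x ∈ U ∩ g⁻¹{y}`. -/
noncomputable def regularDegree {n : ℕ}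
    (g : EuclideanSpace ℝ (Fin n) → EuclideanSpace ℝ (Fin n))
    (U : Set (EuclideanSpace ℝ (Fin n))) (y : EuclideanSpace ℝ (Fin n)) : ℤ :=
  ∑ᶠ x ∈ U ∩ g ⁻¹' {y}, (SignType.sign (fderiv ℝ g x).det : ℤ)

/-- `d` is the degree at `y` of some smooth map `g` which has `y` as a regular value and satisfies
`|f - g| < dist(y, f(∂U))` on the closure of `U`. For `U` bounded and open, `f` continuous on the
closure of `U` and `y ∉ f(∂U)` there is exactly one such `d`, the degree of `f`. -/
def IsBrouwerDegree {n : ℕ} (f : EuclideanSpace ℝ (Fin n) → EuclideanSpace ℝ (Fin n))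
    (U : Set (EuclideanSpace ℝ (Fin n))) (y : EuclideanSpace ℝ (Fin n)) (d : ℤ) : Prop :=
  ∃ g : EuclideanSpace ℝ (Fin n) → EuclideanSpace ℝ (Fin n),
    ContDiff ℝ ∞ g ∧
    (∀ x ∈ closure U, dist (f x) (g x) < Metric.infDist y (f '' frontier U)) ∧
    IsRegularValueOn g U y ∧
    regularDegree g U y = d

open Classical in
/-- The topological degree `deg(f, U, y)` (with value `0` where it is undefined, that is, for
`y ∈ f(∂U)`). -/
noncomputable def brouwerDegree {n : ℕ}
    (f : EuclideanSpace ℝ (Fin n) → EuclideanSpace ℝ (Fin n))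
    (U : Set (EuclideanSpace ℝ (Fin n))) (y : EuclideanSpace ℝ (Fin n)) : ℤ :=
  if h : ∃ d : ℤ, IsBrouwerDegree f U y d then h.choose else 0

/-! ### The map `h(x) = (x₁, x₂, u(x))` -/

/-- `h(x) = (x₁, x₂, u(x))`. -/
noncomputable def graphMap (u : EuclideanSpace ℝ (Fin 3) → ℝ)
    (x : EuclideanSpace ℝ (Fin 3)) : EuclideanSpace ℝ (Fin 3) :=
  !₂[x 0, x 1, u x]

/-! Let `ν` be the image under `h` of `D_3u` restricted to `U`. Off `N = h(∂U)` the measure `ν` has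
density `deg(h,U,·)` with respect to Lebesgue measure, and it gives `N` mass zero. Hence `∫ deg =
ν(Nᶜ) = ν(ℝ³) = D_3u(U)`.

Density. For smooth `v` the Jacobian of `x ↦ (x₁,x₂,v(x))` is `∂_3 v` (`det_fderiv_graphMap`). Let
`g` be a smooth map computing the degree at `z₀`. For `f` supported near `z₀`, `∫_U f(g) J_g = deg ∫
f` (`exists_integral_mul_det_eq_regularDegree_mul`). Jacobians are null Lagrangians, so this
integral does not change along the segment from `g` to a mollified `h`
(`integral_mul_det_eq_of_homotopy`). Mollifications `v_m` of `u` converge uniformly, and `∂_3 v_m`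
converges to `D_3u` against uniformly convergent test functions (`exists_contDiff_approx`). The
limit is `∫ f dν = deg ∫ f` (`exists_vectorIntegral_comp_graphMap_eq`).

Null set. With `G(y) = ∫₀^{y₃} F(y₁,y₂,s) ds`, the chain rule reads `D_3(G(h)) = F(h) D_3u`
(`vectorIntegral_mul_comp_graphMap`). Let `F` tend to the indicator of `N`. By Fubini almost every
vertical line meets the null set `N` in a null set, so `G(h) → 0` a.e. and `D_3u` does not charge `U
∩ h⁻¹(N)` (`apply_inter_preimage_graphMap_eq_zero`).

Integrability comes from the finiteness of `ν`: on countably many disjoint pieces the degree is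
constant and `∑ |ν(A_i)|` converges (`integrable_of_local_density`). -/

/-! ### Jacobians of maps of `ℝ³` as null Lagrangians -/

/-- The Euclidean space `ℝ³`. -/
abbrev R3 := EuclideanSpace ℝ (Fin 3)

/-- The partial derivative `∂_i f`. -/
noncomputable def pderiv3 (i : Fin 3) (f : R3 → ℝ) (x : R3) : ℝ :=
  fderiv ℝ f x (EuclideanSpace.single i 1)

/-- The triple product `∇a · (∇b × ∇c)`. -/
noncomputable def jac (a b c : R3 → ℝ) (x : R3) : ℝ :=
  pderiv3 0 c x * (pderiv3 1 a x * pderiv3 2 b x - pderiv3 2 a x * pderiv3 1 b x) +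
  pderiv3 1 c x * (pderiv3 2 a x * pderiv3 0 b x - pderiv3 0 a x * pderiv3 2 b x) +
  pderiv3 2 c x * (pderiv3 0 a x * pderiv3 1 b x - pderiv3 1 a x * pderiv3 0 b x)

lemma jac_cycle (a b c : R3 → ℝ) (x : R3) : jac a b c x = jac b c a x := by
  simp only [jac]; ring

lemma contDiff_pderiv3 {f : R3 → ℝ} (hf : ContDiff ℝ ∞ f) (i : Fin 3) :
    ContDiff ℝ ∞ (pderiv3 i f) := by
  have : ContDiff ℝ ∞ (fderiv ℝ f) := hf.fderiv_right (by simp)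
  exact this.clm_apply contDiff_const

lemma continuous_pderiv3 {f : R3 → ℝ} (hf : ContDiff ℝ 1 f) (i : Fin 3) :
    Continuous (pderiv3 i f) :=
  (hf.continuous_fderiv one_ne_zero).clm_apply continuous_const

lemma hasCompactSupport_pderiv3 {f : R3 → ℝ} (hf : HasCompactSupport f) (i : Fin 3) :
    HasCompactSupport (pderiv3 i f) := by
  refine (hf.fderiv (𝕜 := ℝ)).mono' (subset_closure.trans' ?_)
  intro x hx h
  exact hx (by simp [pderiv3, h])

lemma pderiv3_mul {f g : R3 → ℝ} {x : R3} (hf : DifferentiableAt ℝ f x)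
    (hg : DifferentiableAt ℝ g x) (i : Fin 3) :
    pderiv3 i (fun y => f y * g y) x = f x * pderiv3 i g x + g x * pderiv3 i f x := by
  simp [pderiv3, fderiv_fun_mul hf hg]

lemma pderiv3_sub {f g : R3 → ℝ} {x : R3} (hf : DifferentiableAt ℝ f x)
    (hg : DifferentiableAt ℝ g x) (i : Fin 3) :
    pderiv3 i (fun y => f y - g y) x = pderiv3 i f x - pderiv3 i g x := by
  simp [pderiv3, fderiv_fun_sub hf hg]

lemma pderiv3_comm {f : R3 → ℝ} (hf : ContDiff ℝ ∞ f) (i j : Fin 3) (x : R3) :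
    pderiv3 i (pderiv3 j f) x = pderiv3 j (pderiv3 i f) x := by
  have hd : DifferentiableAt ℝ (fderiv ℝ f) x :=
    ((hf.fderiv_right (m := ∞) (by simp)).differentiable (by simp)) x
  have key : ∀ k l : Fin 3, pderiv3 k (pderiv3 l f) x =
      fderiv ℝ (fderiv ℝ f) x (EuclideanSpace.single k 1) (EuclideanSpace.single l 1) := by
    intro k l
    have : pderiv3 l f = fun y => fderiv ℝ f y (EuclideanSpace.single l 1) := rfl
    rw [pderiv3, this, fderiv_clm_apply hd (differentiableAt_const _)]
    simp
  rw [key, key]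
  exact (hf.contDiffAt.isSymmSndFDerivAt
    (by simpa using (WithTop.coe_le_coe.2 le_top : ((2 : ℕ∞) : ℕ∞ω) ≤ ∞))).eq _ _

lemma integral_pderiv3_mul {w A : R3 → ℝ} (hw : ContDiff ℝ 1 w) (hwc : HasCompactSupport w)
    (hA : ContDiff ℝ 1 A) (i : Fin 3) :
    ∫ x, pderiv3 i w x * A x = - ∫ x, w x * pderiv3 i A x := by
  have h := integral_mul_fderiv_eq_neg_fderiv_mul_of_integrable (μ := volume)
    (f := w) (g := A) (v := EuclideanSpace.single i (1 : ℝ)) ?_ ?_ ?_ ?_ ?_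
  · simp only [pderiv3]; rw [h, neg_neg]
  · exact ((continuous_pderiv3 hw i).mul hA.continuous).integrable_of_hasCompactSupport
      (hasCompactSupport_pderiv3 hwc i).mul_right
  · exact (hw.continuous.mul (continuous_pderiv3 hA i)).integrable_of_hasCompactSupport
      hwc.mul_right
  · exact (hw.continuous.mul hA.continuous).integrable_of_hasCompactSupport hwc.mul_right
  · exact fun x _ => (hw.differentiable one_ne_zero) x
  · exact fun x _ => (hA.differentiable one_ne_zero) x

/-- The integrand is `∇w · (∇a × ∇b)`. Integration by parts moves the derivative from `w` to `div(∇a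
× ∇b)`, which is zero by symmetry of second derivatives. Only `C¹` is asked of `w`, because it will
be built from a primitive. -/
lemma integral_jac_eq_zero {a b w : R3 → ℝ} (ha : ContDiff ℝ ∞ a) (hb : ContDiff ℝ ∞ b)
    (hw : ContDiff ℝ 1 w) (hwc : HasCompactSupport w) : ∫ x, jac a b w x = 0 := by
  have hA : ∀ i j : Fin 3, ContDiff ℝ ∞
      (fun x => pderiv3 i a x * pderiv3 j b x - pderiv3 j a x * pderiv3 i b x) := fun i j =>
    ((contDiff_pderiv3 ha i).mul (contDiff_pderiv3 hb j)).sub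
      ((contDiff_pderiv3 ha j).mul (contDiff_pderiv3 hb i))
  have hint : ∀ i k l : Fin 3, Integrable
      (fun x => pderiv3 k w x * (pderiv3 i a x * pderiv3 l b x - pderiv3 l a x * pderiv3 i b x)) :=
    fun i k l => ((continuous_pderiv3 hw k).mul (hA i l).continuous).integrable_of_hasCompactSupport
      (hasCompactSupport_pderiv3 hwc k).mul_right
  have hint' : ∀ i k l : Fin 3, Integrable (fun x => w x * pderiv3 k
      (fun x => pderiv3 i a x * pderiv3 l b x - pderiv3 l a x * pderiv3 i b x) x) :=
    fun i k l => (hw.continuous.mul (contDiff_pderiv3 (hA i l) k).continuous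
      ).integrable_of_hasCompactSupport hwc.mul_right
  have hparts : ∀ i k l : Fin 3, ∫ x, pderiv3 k w x *
      (pderiv3 i a x * pderiv3 l b x - pderiv3 l a x * pderiv3 i b x) = - ∫ x, w x * pderiv3 k
      (fun x => pderiv3 i a x * pderiv3 l b x - pderiv3 l a x * pderiv3 i b x) x := fun i k l =>
    integral_pderiv3_mul hw hwc ((hA i l).of_le (by exact_mod_cast le_top)) k
  have hadd : ∀ {f g h : R3 → ℝ}, Integrable f → Integrable g → Integrable h →
      ∫ x, f x + g x + h x = (∫ x, f x) + (∫ x, g x) + ∫ x, h x := by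
    intro f g h hf hg hh
    rw [integral_add (f := fun x => f x + g x) (hf.add hg) hh, integral_add hf hg]
  simp only [jac]
  rw [hadd (hint 1 0 2) (hint 2 1 0) (hint 0 2 1), hparts 1 0 2, hparts 2 1 0, hparts 0 2 1,
    ← neg_add, ← neg_add, ← hadd (hint' 1 0 2) (hint' 2 1 0) (hint' 0 2 1), neg_eq_zero]
  refine integral_eq_zero_of_ae (ae_of_all _ fun x => ?_)
  have hda : ∀ i, DifferentiableAt ℝ (pderiv3 i a) x := fun i =>
    ((contDiff_pderiv3 ha i).differentiable (by simp)) x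
  have hdb : ∀ i, DifferentiableAt ℝ (pderiv3 i b) x := fun i =>
    ((contDiff_pderiv3 hb i).differentiable (by simp)) x
  have hexp : ∀ i k l : Fin 3, pderiv3 k
      (fun x => pderiv3 i a x * pderiv3 l b x - pderiv3 l a x * pderiv3 i b x) x =
      (pderiv3 i a x * pderiv3 k (pderiv3 l b) x + pderiv3 l b x * pderiv3 k (pderiv3 i a) x) -
      (pderiv3 l a x * pderiv3 k (pderiv3 i b) x + pderiv3 i b x * pderiv3 k (pderiv3 l a) x) := by
    intro i k l
    rw [pderiv3_sub (f := fun x => pderiv3 i a x * pderiv3 l b x)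
      (g := fun x => pderiv3 l a x * pderiv3 i b x) ((hda i).mul (hdb l)) ((hda l).mul (hdb i)), pderiv3_mul (hda i) (hdb l),
      pderiv3_mul (hda l) (hdb i)]
  simp only [hexp, Pi.zero_apply]
  rw [pderiv3_comm ha 1 0, pderiv3_comm ha 2 0, pderiv3_comm ha 2 1, pderiv3_comm hb 1 0,
    pderiv3_comm hb 2 0, pderiv3_comm hb 2 1]
  ring

/-- If `φ` is locally constant where `w ≠ 0`, then `∫ φ ∇a · (∇b × ∇w) = 0`. -/
lemma integral_mul_jac_eq_zero {φ a b w : R3 → ℝ} (hφ : ContDiff ℝ ∞ φ)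
    (hφc : HasCompactSupport φ) (ha : ContDiff ℝ ∞ a) (hb : ContDiff ℝ ∞ b)
    (hw : ContDiff ℝ 1 w) (h : ∀ x, fderiv ℝ φ x ≠ 0 → w x = 0) :
    ∫ x, φ x * jac a b w x = 0 := by
  have hφ1 : ContDiff ℝ 1 φ := hφ.of_le (by exact_mod_cast le_top)
  -- Since `w ∇φ = 0`, the gradient of `φ w` is `φ ∇w`, so the integrand is the triple product of
  -- `a`, `b`, `φ w`.
  rw [← integral_jac_eq_zero ha hb (hφ1.mul hw) hφc.mul_right]
  refine integral_congr_ae (ae_of_all _ fun x => ?_)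
  have hz : ∀ i, w x * pderiv3 i φ x = 0 := by
    intro i
    by_cases hx : fderiv ℝ φ x = 0
    · simp [pderiv3, hx]
    · simp [h x hx]
  have hmul : ∀ i, pderiv3 i (fun x => φ x * w x) x = φ x * pderiv3 i w x := by
    intro i
    rw [pderiv3_mul (hφ1.differentiable one_ne_zero x) (hw.differentiable one_ne_zero x), hz,
      add_zero]
  simp only [jac, hmul]
  ring

/-! ### Maps in coordinates, and primitives in the third variable. -/

lemma contDiff_intervalIntegral {F : R3 × ℝ → ℝ} (hF : ContDiff ℝ 1 F) :
    ContDiff ℝ 1 (fun y : R3 => ∫ s in (0 : ℝ)..1, F (y, s)) := by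
  set F' : R3 → ℝ → R3 →L[ℝ] ℝ := fun y s =>
    (fderiv ℝ F (y, s)).comp (ContinuousLinearMap.inl ℝ R3 ℝ) with hF'def
  have hF'c : Continuous (Function.uncurry F') := by
    have : Continuous (fderiv ℝ F) := hF.continuous_fderiv one_ne_zero
    exact (this.comp (by fun_prop : Continuous fun p : R3 × ℝ => (p.1, p.2))).clm_comp
      continuous_const
  have hder : ∀ y s, HasFDerivAt (fun z => F (z, s)) (F' y s) y := by
    intro y s
    exact ((hF.differentiable one_ne_zero) (y, s)).hasFDerivAt.comp y
      (hasFDerivAt_prodMk_left y s)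
  have hd : ∀ y : R3, HasFDerivAt (fun y : R3 => ∫ s in (0 : ℝ)..1, F (y, s))
      (∫ s in (0 : ℝ)..1, F' y s) y := by
    intro y
    obtain ⟨C, hC⟩ := ((isCompact_closedBall y 1).prod (isCompact_Icc (a := (0 : ℝ)) (b := 1))
      ).exists_bound_of_continuousOn hF'c.continuousOn
    refine intervalIntegral.hasFDerivAt_integral_of_dominated_of_fderiv_le (bound := fun _ => C)
      (Metric.closedBall_mem_nhds y one_pos) ?_ ?_ ?_ ?_ ?_ ?_
    · exact Filter.Eventually.of_forall fun z =>
        (hF.continuous.comp (by fun_prop : Continuous fun s : ℝ => (z, s))).aestronglyMeasurable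
    · exact (hF.continuous.comp (by fun_prop : Continuous fun s : ℝ => (y, s))
        ).intervalIntegrable _ _
    · exact (hF'c.comp (by fun_prop : Continuous fun s : ℝ => (y, s))).aestronglyMeasurable
    · refine ae_of_all _ fun s hs z hz => hC (z, s) ⟨hz, ?_⟩
      rw [uIoc_of_le zero_le_one] at hs
      exact ⟨hs.1.le, hs.2⟩
    · exact intervalIntegrable_const
    · exact ae_of_all _ fun s _ z _ => hder z s
  rw [contDiff_one_iff_fderiv]
  refine ⟨fun y => (hd y).differentiableAt, ?_⟩
  have : fderiv ℝ (fun y : R3 => ∫ s in (0 : ℝ)..1, F (y, s)) =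
      fun y => ∫ s in (0 : ℝ)..1, F' y s := funext fun y => (hd y).fderiv
  rw [this]
  exact intervalIntegral.continuous_parametric_intervalIntegral_of_continuous' hF'c 0 1

/-- The vector field with components `a`, `b`, `c`. -/
noncomputable def vec3 (a b c : R3 → ℝ) (x : R3) : R3 := !₂[a x, b x, c x]

lemma vec3_eq_sum (p q r : ℝ) : (!₂[p, q, r] : R3) = p • EuclideanSpace.single 0 1 +
    q • EuclideanSpace.single 1 1 + r • EuclideanSpace.single 2 1 := by
  ext i; fin_cases i <;> simp

lemma hasFDerivAt_vec3 {a b c : R3 → ℝ} {x : R3} (ha : DifferentiableAt ℝ a x)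
    (hb : DifferentiableAt ℝ b x) (hc : DifferentiableAt ℝ c x) :
    HasFDerivAt (vec3 a b c) ((fderiv ℝ a x).smulRight (EuclideanSpace.single 0 1) +
      (fderiv ℝ b x).smulRight (EuclideanSpace.single 1 1) +
      (fderiv ℝ c x).smulRight (EuclideanSpace.single 2 (1 : ℝ))) x := by
  have h : vec3 a b c = fun x => a x • (EuclideanSpace.single 0 1 : R3) +
      b x • EuclideanSpace.single 1 1 + c x • EuclideanSpace.single 2 1 :=
    funext fun x => vec3_eq_sum _ _ _
  rw [h]
  exact ((ha.hasFDerivAt.smul_const _).add (hb.hasFDerivAt.smul_const _)).add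
    (hc.hasFDerivAt.smul_const _)

lemma contDiff_vec3 {n : ℕ∞ω} {a b c : R3 → ℝ} (ha : ContDiff ℝ n a) (hb : ContDiff ℝ n b)
    (hc : ContDiff ℝ n c) : ContDiff ℝ n (vec3 a b c) := by
  have h : vec3 a b c = fun x => a x • (EuclideanSpace.single 0 1 : R3) +
      b x • EuclideanSpace.single 1 1 + c x • EuclideanSpace.single 2 1 :=
    funext fun x => vec3_eq_sum _ _ _
  rw [h]
  fun_prop

lemma continuous_vec3 {X : Type*} [TopologicalSpace X] {a b c : X → ℝ} (ha : Continuous a)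
    (hb : Continuous b) (hc : Continuous c) : Continuous fun x => (!₂[a x, b x, c x] : R3) := by
  simp only [vec3_eq_sum]
  fun_prop

/-- The chain rule in coordinates. -/
lemma pderiv3_comp_vec3 {G a b c : R3 → ℝ} {x : R3} (hG : DifferentiableAt ℝ G (vec3 a b c x))
    (ha : DifferentiableAt ℝ a x) (hb : DifferentiableAt ℝ b x) (hc : DifferentiableAt ℝ c x)
    (i : Fin 3) :
    pderiv3 i (fun y => G (vec3 a b c y)) x = pderiv3 0 G (vec3 a b c x) * pderiv3 i a x +
      pderiv3 1 G (vec3 a b c x) * pderiv3 i b x + pderiv3 2 G (vec3 a b c x) * pderiv3 i c x := by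
  have h := hG.hasFDerivAt.comp x (hasFDerivAt_vec3 ha hb hc)
  have h' : fderiv ℝ (fun y => G (vec3 a b c y)) x = _ := h.fderiv
  simp only [pderiv3, h']
  simp [mul_comm]

/-- The determinant of the derivative in coordinates. -/
lemma det_fderiv_vec3 {a b c : R3 → ℝ} {x : R3} (ha : DifferentiableAt ℝ a x)
    (hb : DifferentiableAt ℝ b x) (hc : DifferentiableAt ℝ c x) :
    (fderiv ℝ (vec3 a b c) x).det = jac a b c x := by
  rw [(hasFDerivAt_vec3 ha hb hc).fderiv, ContinuousLinearMap.det,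
    ← LinearMap.det_toMatrix (EuclideanSpace.basisFun (Fin 3) ℝ).toBasis, Matrix.det_fin_three]
  simp [LinearMap.toMatrix_apply, jac, pderiv3]
  ring

/-- The primitive `y ↦ ∫₀^{y₃} f(y₁, y₂, s) ds` of `f` in the third variable. -/
noncomputable def primitive3 (f : R3 → ℝ) (y : R3) : ℝ := ∫ s in (0 : ℝ)..y 2, f !₂[y 0, y 1, s]

/-- Rescaling to the fixed interval `[0,1]` reduces regularity of the primitive to that of an
integral depending on a parameter. -/
lemma primitive3_eq_mul (f : R3 → ℝ) :
    primitive3 f = fun y => y 2 * ∫ s in (0 : ℝ)..1, f !₂[y 0, y 1, s * y 2] := by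
  funext y
  have := intervalIntegral.mul_integral_comp_mul_right (a := 0) (b := 1)
    (f := fun s => f !₂[y 0, y 1, s]) (y 2)
  rw [this]; simp [primitive3]

lemma continuous_primitive3 {f : R3 → ℝ} (hf : Continuous f) : Continuous (primitive3 f) := by
  rw [primitive3_eq_mul]
  refine Continuous.mul (by fun_prop)
    (intervalIntegral.continuous_parametric_intervalIntegral_of_continuous' ?_ 0 1)
  refine hf.comp ?_
  simp only [vec3_eq_sum]
  fun_prop

lemma contDiff_primitive3 {f : R3 → ℝ} (hf : ContDiff ℝ 1 f) : ContDiff ℝ 1 (primitive3 f) := by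
  rw [primitive3_eq_mul]
  have hF : ContDiff ℝ 1 (fun p : R3 × ℝ => f !₂[p.1 0, p.1 1, p.2 * p.1 2]) := by
    refine hf.comp ?_
    simp only [vec3_eq_sum]
    fun_prop
  exact ContDiff.mul (by fun_prop) (contDiff_intervalIntegral hF)

lemma hasDerivAt_primitive3 {f : R3 → ℝ} (hf : Continuous f) (p q r : ℝ) :
    HasDerivAt (fun t => primitive3 f !₂[p, q, t]) (f !₂[p, q, r]) r := by
  have hc : Continuous fun s : ℝ => f !₂[p, q, s] :=
    hf.comp (continuous_vec3 continuous_const continuous_const continuous_id)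
  simpa [primitive3] using intervalIntegral.integral_hasDerivAt_right (hc.intervalIntegrable 0 r)
    hc.stronglyMeasurable.stronglyMeasurableAtFilter hc.continuousAt

lemma pderiv3_primitive3 {f : R3 → ℝ} (hf : ContDiff ℝ 1 f) (p q r : ℝ) :
    pderiv3 2 (primitive3 f) !₂[p, q, r] = f !₂[p, q, r] := by
  have h1 := hasDerivAt_primitive3 hf.continuous p q r
  have h2 : HasDerivAt (fun t : ℝ => (!₂[p, q, t] : R3)) (EuclideanSpace.single 2 1) r := by
    simp only [vec3_eq_sum]
    simpa using ((hasDerivAt_id r).smul_const (EuclideanSpace.single 2 (1 : ℝ) : R3)).const_add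
      (p • EuclideanSpace.single 0 1 + q • EuclideanSpace.single 1 1 : R3)
  have h3 := ((contDiff_primitive3 hf).differentiable one_ne_zero !₂[p, q, r]).hasFDerivAt
    |>.comp_hasDerivAt r h2
  exact h3.unique h1

/-! ### Homotopy invariance of `∫ φ f(g) J_g`. -/

/-- Changing the last component of a map does not change `∫ φ f(g) J_g`, if `f` vanishes along the
change where `φ` is not locally constant. -/
lemma integral_mul_jac_eq_of_last {φ f a b c c' : R3 → ℝ} (hφ : ContDiff ℝ ∞ φ)
    (hφc : HasCompactSupport φ) (hf : ContDiff ℝ ∞ f) (ha : ContDiff ℝ ∞ a) (hb : ContDiff ℝ ∞ b)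
    (hc : ContDiff ℝ ∞ c) (hc' : ContDiff ℝ ∞ c')
    (h : ∀ x, fderiv ℝ φ x ≠ 0 → ∀ s ∈ uIcc (c x) (c' x), f !₂[a x, b x, s] = 0) :
    ∫ x, φ x * (f (vec3 a b c x) * jac a b c x) = ∫ x, φ x * (f (vec3 a b c' x) * jac a b c' x) := by
  have hf1 : ContDiff ℝ 1 f := hf.of_le (by exact_mod_cast le_top)
  have h1 : ∀ {g : R3 → ℝ}, ContDiff ℝ ∞ g → ContDiff ℝ 1 g := fun hg =>
    hg.of_le (by exact_mod_cast le_top)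
  have hG := contDiff_primitive3 hf1
  have hint : ∀ d : R3 → ℝ, ContDiff ℝ ∞ d →
      Integrable (fun x => φ x * (f (vec3 a b d x) * jac a b d x)) := by
    intro d hd
    refine Continuous.integrable_of_hasCompactSupport (hφ.continuous.mul
      ((hf.continuous.comp (contDiff_vec3 ha hb hd).continuous).mul ?_)) hφc.mul_right
    have := fun i => (contDiff_pderiv3 ha i).continuous
    have := fun i => (contDiff_pderiv3 hb i).continuous
    have := fun i => (contDiff_pderiv3 hd i).continuous
    unfold jac
    fun_prop
  have hw := fun (d : R3 → ℝ) (hd : ContDiff ℝ ∞ d) =>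
    hG.comp (contDiff_vec3 (h1 ha) (h1 hb) (h1 hd))
  -- With `G` the primitive of `f`, the gradient of `G(a,b,c)` is a combination of `∇a` and `∇b`,
  -- which drops out of the triple product, plus `f(a,b,c) ∇c`. So the difference of the two
  -- integrands is `φ` times the triple product of `a`, `b`, `G(a,b,c') - G(a,b,c)`.
  have hzero := integral_mul_jac_eq_zero hφ hφc ha hb ((hw c' hc').sub (hw c hc)) ?_
  · rw [eq_comm, ← sub_eq_zero, ← integral_sub (hint c' hc') (hint c hc), ← hzero]
    refine integral_congr_ae (ae_of_all _ fun x => ?_)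
    have hdG : ∀ y, DifferentiableAt ℝ (primitive3 f) y := hG.differentiable one_ne_zero
    have hd : ∀ {g : R3 → ℝ}, ContDiff ℝ ∞ g → DifferentiableAt ℝ g x := fun hg =>
      hg.differentiable (by simp) x
    have hp : ∀ i, pderiv3 i (fun x => primitive3 f (vec3 a b c' x) - primitive3 f (vec3 a b c x)) x
        = (pderiv3 0 (primitive3 f) (vec3 a b c' x) * pderiv3 i a x +
          pderiv3 1 (primitive3 f) (vec3 a b c' x) * pderiv3 i b x +
          f (vec3 a b c' x) * pderiv3 i c' x) -
          (pderiv3 0 (primitive3 f) (vec3 a b c x) * pderiv3 i a x +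
          pderiv3 1 (primitive3 f) (vec3 a b c x) * pderiv3 i b x +
          f (vec3 a b c x) * pderiv3 i c x) := by
      intro i
      rw [pderiv3_sub (f := fun x => primitive3 f (vec3 a b c' x))
        (g := fun x => primitive3 f (vec3 a b c x)) ((hw c' hc').differentiable one_ne_zero x)
        ((hw c hc).differentiable one_ne_zero x), pderiv3_comp_vec3 (hdG _) (hd ha) (hd hb) (hd hc'),
        pderiv3_comp_vec3 (hdG _) (hd ha) (hd hb) (hd hc)]
      rw [show pderiv3 2 (primitive3 f) (vec3 a b c' x) = f (vec3 a b c' x) from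
        pderiv3_primitive3 hf1 _ _ _, show pderiv3 2 (primitive3 f) (vec3 a b c x) =
        f (vec3 a b c x) from pderiv3_primitive3 hf1 _ _ _]
    simp only [jac, Function.comp_apply, hp]
    ring
  · intro x hx
    -- This integral is `G(a,b,c') - G(a,b,c)` at `x`, which must vanish wherever `∇φ ≠ 0`.
    have : ∫ s in (c x)..(c' x), f !₂[a x, b x, s] = 0 := by
      rw [intervalIntegral.integral_congr (g := fun _ => 0) (fun s hs => h x hx s hs)]
      simp
    have hcont : Continuous fun s : ℝ => f !₂[a x, b x, s] :=
      hf.continuous.comp (continuous_vec3 continuous_const continuous_const continuous_id)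
    rw [← this]
    simpa [primitive3, vec3] using intervalIntegral.integral_interval_sub_left
      (hcont.intervalIntegrable 0 (c' x)) (hcont.intervalIntegrable 0 (c x))

/-- The components are replaced one at a time. Cyclic symmetry of `jac`, with the arguments of `f`
rotated to match, brings each of them into the last slot. -/
lemma integral_mul_jac_eq_of_segment {φ f : R3 → ℝ} {a b c a' b' c' : R3 → ℝ}
    (hφ : ContDiff ℝ ∞ φ) (hφc : HasCompactSupport φ) (hf : ContDiff ℝ ∞ f)
    (ha : ContDiff ℝ ∞ a) (hb : ContDiff ℝ ∞ b) (hc : ContDiff ℝ ∞ c)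
    (ha' : ContDiff ℝ ∞ a') (hb' : ContDiff ℝ ∞ b') (hc' : ContDiff ℝ ∞ c')
    (h : ∀ x, fderiv ℝ φ x ≠ 0 → ∀ p ∈ uIcc (a x) (a' x), ∀ q ∈ uIcc (b x) (b' x),
      ∀ r ∈ uIcc (c x) (c' x), f !₂[p, q, r] = 0) :
    ∫ x, φ x * (f (vec3 a b c x) * jac a b c x) =
      ∫ x, φ x * (f (vec3 a' b' c' x) * jac a' b' c' x) := by
  have hrot : ContDiff ℝ ∞ fun y : R3 => (!₂[y 2, y 0, y 1] : R3) := by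
    simp only [vec3_eq_sum]; fun_prop
  have hrot' : ContDiff ℝ ∞ fun y : R3 => (!₂[y 1, y 2, y 0] : R3) := by
    simp only [vec3_eq_sum]; fun_prop
  calc ∫ x, φ x * (f (vec3 a b c x) * jac a b c x)
      = ∫ x, φ x * (f (vec3 a b c' x) * jac a b c' x) :=
        integral_mul_jac_eq_of_last hφ hφc hf ha hb hc hc'
          fun x hx s hs => h x hx _ left_mem_uIcc _ left_mem_uIcc _ hs
    _ = ∫ x, φ x * (f (vec3 a' b c' x) * jac a' b c' x) := by
        have := integral_mul_jac_eq_of_last hφ hφc (hf.comp hrot) hb hc' ha ha'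
          fun x hx s hs => by
            simpa using h x hx _ hs _ left_mem_uIcc _ right_mem_uIcc
        simpa [vec3, jac_cycle a, jac_cycle a'] using this
    _ = ∫ x, φ x * (f (vec3 a' b' c' x) * jac a' b' c' x) := by
        have := integral_mul_jac_eq_of_last hφ hφc (hf.comp hrot') hc' ha' hb hb'
          fun x hx s hs => by
            simpa using h x hx _ right_mem_uIcc _ hs _ right_mem_uIcc
        simpa [vec3, ← jac_cycle c'] using this

lemma vec3_components (g : R3 → R3) :
    vec3 (fun x => g x 0) (fun x => g x 1) (fun x => g x 2) = g := by
  funext x; ext i; fin_cases i <;> simp [vec3]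

/-- Invariance of `∫ φ f(g) J_g` under small changes of `g`. -/
lemma integral_mul_det_eq_of_close {φ f : R3 → ℝ} {g k : R3 → R3}
    (hφ : ContDiff ℝ ∞ φ) (hφc : HasCompactSupport φ) (hf : ContDiff ℝ ∞ f)
    (hg : ContDiff ℝ ∞ g) (hk : ContDiff ℝ ∞ k)
    (h : ∀ x, fderiv ℝ φ x ≠ 0 → ∀ y, dist y (g x) ≤ dist (k x) (g x) → f y = 0) :
    ∫ x, φ x * (f (g x) * (fderiv ℝ g x).det) = ∫ x, φ x * (f (k x) * (fderiv ℝ k x).det) := by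
  have hcomp : ∀ {l : R3 → R3}, ContDiff ℝ ∞ l → ∀ i, ContDiff ℝ ∞ fun x => l x i := by
    intro l hl i; fun_prop
  have key := integral_mul_jac_eq_of_segment hφ hφc hf (hcomp hg 0) (hcomp hg 1) (hcomp hg 2)
    (hcomp hk 0) (hcomp hk 1) (hcomp hk 2) ?_
  · simp only [vec3_components] at key
    have hdet : ∀ {l : R3 → R3}, ContDiff ℝ ∞ l → ∀ x, (fderiv ℝ l x).det =
        jac (fun x => l x 0) (fun x => l x 1) (fun x => l x 2) x := by
      intro l hl x
      rw [← det_fderiv_vec3 ((hcomp hl 0).differentiable (by simp) x)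
        ((hcomp hl 1).differentiable (by simp) x) ((hcomp hl 2).differentiable (by simp) x),
        vec3_components]
    simp only [hdet hg, hdet hk]
    exact key
  · intro x hx p hp q hq r hr
    -- The coordinate box with opposite corners `g x` and `k x` lies in the closed ball about `g x`
    -- of radius `dist (k x) (g x)`.
    refine h x hx _ ?_
    rw [EuclideanSpace.dist_eq, EuclideanSpace.dist_eq]
    refine Real.sqrt_le_sqrt ?_
    have habs : ∀ {s t t' : ℝ}, s ∈ uIcc t t' → dist s t ^ 2 ≤ dist t' t ^ 2 := by
      intro s t t' hs
      have := abs_sub_left_of_mem_uIcc hs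
      exact pow_le_pow_left₀ dist_nonneg (by simpa [Real.dist_eq] using this) 2
    simp only [Fin.sum_univ_three]
    exact add_le_add (add_le_add (habs hp) (habs hq)) (habs hr)

/-- Invariance of `∫ φ f(g) J_g` along the segment from `g` to `k`, if `f` vanishes near the
segment where `φ` is not locally constant. -/
lemma integral_mul_det_eq_of_homotopy {φ f : R3 → ℝ} {g k : R3 → R3}
    (hφ : ContDiff ℝ ∞ φ) (hφc : HasCompactSupport φ) (hf : ContDiff ℝ ∞ f)
    (hg : ContDiff ℝ ∞ g) (hk : ContDiff ℝ ∞ k) {η : ℝ} (hη : 0 < η)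
    (h : ∀ x, fderiv ℝ φ x ≠ 0 → ∀ t ∈ Icc (0 : ℝ) 1, ∀ y,
      dist y (g x + t • (k x - g x)) ≤ η → f y = 0) :
    ∫ x, φ x * (f (g x) * (fderiv ℝ g x).det) = ∫ x, φ x * (f (k x) * (fderiv ℝ k x).det) := by
  obtain ⟨M, hM⟩ := hφc.isCompact.exists_bound_of_continuousOn
    (hk.continuous.sub hg.continuous).continuousOn
  -- Cutting the segment into `m + 1` steps makes each step at most `M / (m + 1) < η` long on the
  -- support of `φ`.
  obtain ⟨m, hm⟩ := exists_nat_gt (M / η)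
  set gj : ℕ → R3 → R3 := fun j x => g x + ((j : ℝ) / (m + 1)) • (k x - g x) with hgj
  have hsm : ∀ j, ContDiff ℝ ∞ (gj j) := fun j => by simp only [hgj]; fun_prop
  have hm1 : (0 : ℝ) < m + 1 := by positivity
  have hstep : ∀ j : ℕ, j ≤ m + 1 →
      ∫ x, φ x * (f (gj 0 x) * (fderiv ℝ (gj 0) x).det) =
        ∫ x, φ x * (f (gj j x) * (fderiv ℝ (gj j) x).det) := by
    intro j
    induction j with
    | zero => intro _; rfl
    | succ j ih =>
      intro hj
      rw [ih (by omega)]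
      refine integral_mul_det_eq_of_close hφ hφc hf (hsm j) (hsm (j + 1)) fun x hx y hy => ?_
      refine h x hx ((j : ℝ) / (m + 1)) ⟨by positivity, ?_⟩ y (hy.trans ?_)
      · rw [div_le_one hm1]; exact_mod_cast (by omega : j ≤ m + 1)
      · have hdiff : gj (j + 1) x - gj j x = (1 / ((m : ℝ) + 1)) • (k x - g x) := by
          simp only [hgj, add_sub_add_left_eq_sub, ← sub_smul]
          congr 1; push_cast; field_simp; ring
        have hxs : x ∈ tsupport φ := by
          by_contra hn
          exact hx (image_eq_zero_of_notMem_tsupport fun h' => hn (tsupport_fderiv_subset ℝ h'))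
        rw [dist_eq_norm, hdiff, norm_smul, Real.norm_of_nonneg (by positivity), one_div,
          inv_mul_le_iff₀ hm1]
        have h1 : ‖k x - g x‖ ≤ M := hM x hxs
        rw [div_lt_iff₀ hη] at hm
        nlinarith
  have h0 : gj 0 = g := by funext x; simp [hgj]
  have h1 : gj (m + 1) = k := by
    funext x
    simp only [hgj]; push_cast; rw [div_self hm1.ne', one_smul, add_sub_cancel]
  rw [← h0, ← h1]
  exact hstep (m + 1) le_rfl

/-! ### The degree at a regular value as an integral -/

section RegularValue

variable {n : ℕ}

lemma exists_isOpen_injOn_of_det_ne_zero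
    {g : EuclideanSpace ℝ (Fin n) → EuclideanSpace ℝ (Fin n)} (hg : ContDiff ℝ ∞ g)
    {x : EuclideanSpace ℝ (Fin n)} (hx : (fderiv ℝ g x).det ≠ 0)
    {W : Set (EuclideanSpace ℝ (Fin n))} (hW : IsOpen W) (hxW : x ∈ W) :
    ∃ V, IsOpen V ∧ x ∈ V ∧ V ⊆ W ∧ InjOn g V ∧ g '' V ∈ nhds (g x) ∧
      ∀ y ∈ V, SignType.sign (fderiv ℝ g y).det = SignType.sign (fderiv ℝ g x).det := by
  have hstrict : HasStrictFDerivAt g (fderiv ℝ g x) x :=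
    hg.contDiffAt.hasStrictFDerivAt (by simp)
  set e : EuclideanSpace ℝ (Fin n) ≃L[ℝ] EuclideanSpace ℝ (Fin n) :=
    (fderiv ℝ g x).toContinuousLinearEquivOfDetNeZero hx
  have hs : HasStrictFDerivAt g (e : _ →L[ℝ] _) x := by
    simpa [e] using hstrict
  have hdet : Continuous fun y => (fderiv ℝ g y).det :=
    ContinuousLinearMap.continuous_det.comp (hg.continuous_fderiv (by simp))
  have hnear : {y | SignType.sign (fderiv ℝ g y).det = SignType.sign (fderiv ℝ g x).det} ∈
      nhds x := by
    rcases hx.lt_or_gt with h | h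
    · filter_upwards [hdet.continuousAt.eventually (gt_mem_nhds h)] with y hy
      simp [sign_neg h, sign_neg hy]
    · filter_upwards [hdet.continuousAt.eventually (lt_mem_nhds h)] with y hy
      simp [sign_pos h, sign_pos hy]
  obtain ⟨V₁, hV₁, hV₁o, hxV₁⟩ := mem_nhds_iff.1 hnear
  set φ := hs.toOpenPartialHomeomorph g
  have hφs : x ∈ φ.source := hs.mem_toOpenPartialHomeomorph_source
  refine ⟨φ.source ∩ V₁ ∩ W, (φ.open_source.inter hV₁o).inter hW, ⟨⟨hφs, hxV₁⟩, hxW⟩,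
    inter_subset_right, fun y hy z hz h => φ.injOn hy.1.1 hz.1.1 h, ?_,
    fun y hy => hV₁ hy.1.2⟩
  rw [← hs.map_nhds_eq_of_equiv]
  exact Filter.image_mem_map (((φ.open_source.inter hV₁o).inter hW).mem_nhds
    ⟨⟨hφs, hxV₁⟩, hxW⟩)

/-- Near a regular value `z₀`, the degree is given by `∫_U f(g) J_g = deg ∫ f`. -/
theorem exists_integral_mul_det_eq_regularDegree_mul
    {g : EuclideanSpace ℝ (Fin n) → EuclideanSpace ℝ (Fin n)} (hg : ContDiff ℝ ∞ g)
    {U : Set (EuclideanSpace ℝ (Fin n))} (hU : IsOpen U) (hUc : IsCompact (closure U))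
    {z₀ : EuclideanSpace ℝ (Fin n)} (hz₀ : z₀ ∉ g '' frontier U)
    (hreg : IsRegularValueOn g U z₀) :
    ∃ r > 0, ∀ f : EuclideanSpace ℝ (Fin n) → ℝ, Continuous f →
      (∀ z ∉ Metric.ball z₀ r, f z = 0) →
      ∫ x in U, f (g x) * (fderiv ℝ g x).det = regularDegree g U z₀ * ∫ z, f z := by
  classical
  set S := U ∩ g ⁻¹' {z₀} with hS
  -- No preimage of `z₀` lies on `∂U`, so the fibre is compact; it is discrete by the inverse
  -- function theorem, hence finite.
  have hScl : S = closure U ∩ g ⁻¹' {z₀} := by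
    refine subset_antisymm (inter_subset_inter_left _ subset_closure) fun x hx => ⟨?_, hx.2⟩
    by_contra hxU
    exact hz₀ ⟨x, by rw [hU.frontier_eq]; exact ⟨hx.1, hxU⟩, hx.2⟩
  have hSc : IsCompact S := by
    rw [hScl]
    exact hUc.inter_right (isClosed_singleton.preimage hg.continuous)
  have hloc : ∀ x ∈ S, ∀ W, IsOpen W → x ∈ W → ∃ V, IsOpen V ∧ x ∈ V ∧ V ⊆ W ∧ InjOn g V ∧
      g '' V ∈ nhds z₀ ∧
      ∀ y ∈ V, SignType.sign (fderiv ℝ g y).det = SignType.sign (fderiv ℝ g x).det := by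
    intro x hx W hW hxW
    have := exists_isOpen_injOn_of_det_ne_zero hg (hreg x hx.1 hx.2) hW hxW
    rwa [show g x = z₀ from hx.2] at this
  have hSfin : S.Finite := by
    refine hSc.finite (isDiscrete_iff_forall_mem_exists_isOpen.2 fun x hx => ?_)
    obtain ⟨V, hVo, hxV, -, hinj, -, -⟩ := hloc x hx univ isOpen_univ (mem_univ _)
    refine ⟨V, hVo, ?_⟩
    ext y
    constructor
    · rintro ⟨hyV, hyS⟩
      exact hinj hyV hxV (hyS.2.trans hx.2.symm)
    · rintro rfl
      exact ⟨hxV, hx⟩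
  obtain ⟨W, hW, hWdisj⟩ := hSfin.t2_separation
  choose! V hVo hxV hVW hinj himg hsign using fun x hx =>
    hloc x hx (W x ∩ U) ((hW x).2.inter hU) ⟨(hW x).1, hx.1⟩
  set T := ⋃ x ∈ S, V x with hT
  have hTo : IsOpen T := isOpen_biUnion fun x hx => hVo x hx
  -- The ball is chosen inside every `g(V_x)` and away from the compact set `g(closure U \ T)`, so
  -- that only the sheets `V_x` contribute.
  have hrest : (g '' (closure U \ T))ᶜ ∈ nhds z₀ := by
    refine (((hUc.diff hTo).image hg.continuous).isClosed.isOpen_compl).mem_nhds ?_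
    rintro ⟨x, ⟨hxU, hxT⟩, hxz⟩
    have hxS : x ∈ S := by rw [hScl]; exact ⟨hxU, hxz⟩
    exact hxT (mem_biUnion hxS (hxV x hxS))
  have hall : (⋂ x ∈ S, g '' V x) ∈ nhds z₀ := (Filter.biInter_mem hSfin).2 himg
  obtain ⟨r, hr, hball⟩ := Metric.mem_nhds_iff.1 (Filter.inter_mem hall hrest)
  refine ⟨r, hr, fun f hf hfz => ?_⟩
  have hTU : T ⊆ U := iUnion₂_subset fun x hx => (hVW x hx).trans inter_subset_right
  have hcont : Continuous fun x => f (g x) * (fderiv ℝ g x).det :=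
    (hf.comp hg.continuous).mul
      (ContinuousLinearMap.continuous_det.comp (hg.continuous_fderiv (by simp)))
  have hUT : ∫ x in U, f (g x) * (fderiv ℝ g x).det = ∫ x in T, f (g x) * (fderiv ℝ g x).det := by
    refine setIntegral_eq_of_subset_of_forall_sdiff_eq_zero hU.measurableSet hTU fun x hx => ?_
    rw [hfz (g x), zero_mul]
    intro hgx
    exact (hball hgx).2 ⟨x, ⟨subset_closure hx.1, hx.2⟩, rfl⟩
  have hTsum : ∫ x in T, f (g x) * (fderiv ℝ g x).det =
      ∑ x ∈ hSfin.toFinset, ∫ y in V x, f (g y) * (fderiv ℝ g y).det := by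
    have : T = ⋃ x ∈ hSfin.toFinset, V x := by simp [hT]
    rw [this]
    refine integral_biUnion_finset _ (fun x hx => (hVo x (by simpa using hx)).measurableSet) ?_ ?_
    · intro x hx y hy hxy
      have hx' : x ∈ S := by simpa using hx
      have hy' : y ∈ S := by simpa using hy
      exact (hWdisj hx' hy' hxy).mono ((hVW x hx').trans inter_subset_left)
        ((hVW y hy').trans inter_subset_left)
    · intro x hx
      exact (hcont.continuousOn.integrableOn_compact hUc).mono_set
        (((hVW x (by simpa using hx)).trans inter_subset_right).trans subset_closure)
  have hterm : ∀ x ∈ S, ∫ y in V x, f (g y) * (fderiv ℝ g y).det =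
      (SignType.sign (fderiv ℝ g x).det : ℝ) * ∫ z, f z := by
    intro x hx
    -- As `g(V_x)` contains the ball, it carries the whole integral of `f`. The constant sign of
    -- `J_g` on `V_x` turns the change of variables formula for `|J_g|` into a signed one.
    have h1 : ∫ z in g '' V x, f z = ∫ z, f z :=
      setIntegral_eq_integral_of_forall_compl_eq_zero fun z hz =>
        hfz z fun hzb => hz (mem_iInter₂.1 (hball hzb).1 x hx)
    rw [← h1, integral_image_eq_integral_abs_det_fderiv_smul volume (hVo x hx).measurableSet
      (fun y _ => ((hg.differentiable (by simp)) y).hasFDerivAt.hasFDerivWithinAt) (hinj x hx),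
      ← integral_const_mul]
    refine setIntegral_congr_fun (hVo x hx).measurableSet fun y hy => ?_
    simp only [smul_eq_mul]
    rw [← hsign x hx y hy, ← mul_assoc, sign_mul_abs, mul_comm]
  rw [hUT, hTsum, Finset.sum_congr rfl (fun x hx => hterm x (by simpa using hx)), ← Finset.sum_mul,
    regularDegree, finsum_mem_eq_finite_toFinset_sum _ hSfin]
  congr 1
  push_cast
  refine Finset.sum_congr rfl fun x _ => ?_
  rcases SignType.sign (fderiv ℝ g x).det with _ | _ | _ <;> simp

end RegularValue

/-! ### Mollification of continuous functions of bounded variation -/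

open Filter Topology Convolution

instance {X : Type*} [MeasurableSpace X] (μ : SignedMeasure X) :
    IsFiniteMeasure μ.variation := by
  rw [← SignedMeasure.totalVariation_eq_variation]
  unfold SignedMeasure.totalVariation
  infer_instance

lemma exists_contDiff_one_nhdsSet {E : Type*} [NormedAddCommGroup E] [InnerProductSpace ℝ E]
    [FiniteDimensional ℝ E] {K Ω : Set E} (hK : IsCompact K) (hΩ : IsOpen Ω) (h : K ⊆ Ω) :
    ∃ χ : E → ℝ, ContDiff ℝ ∞ χ ∧ HasCompactSupport χ ∧ tsupport χ ⊆ Ω ∧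
      (∀ᶠ x in 𝓝ˢ K, χ x = 1) := by
  obtain ⟨K₁, hK₁, hKK₁, hK₁Ω⟩ := exists_compact_between hK hΩ h
  obtain ⟨χ, h1, h0, -⟩ := exists_contMDiffMap_one_nhds_of_subset_interior (n := ⊤)
    (modelWithCornersSelf ℝ E) hK.isClosed hKK₁
  refine ⟨χ, χ.contMDiff.contDiff, HasCompactSupport.intro hK₁ h0, ?_, h1⟩
  refine (closure_minimal (fun x hx => ?_) hK₁.isClosed).trans hK₁Ω
  by_contra hxK
  exact hx (h0 x hxK)

lemma continuous_mul_of_tsupport_subset {χ u : R3 → ℝ} {Ω : Set R3} (hΩ : IsOpen Ω)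
    (hχ : Continuous χ) (hχΩ : tsupport χ ⊆ Ω) (hu : ContinuousOn u Ω) :
    Continuous fun x => χ x * u x := by
  rw [continuous_iff_continuousAt]
  intro x
  by_cases hx : x ∈ Ω
  · exact hχ.continuousAt.mul (hu.continuousAt (hΩ.mem_nhds hx))
  · have : (fun x => χ x * u x) =ᶠ[𝓝 x] fun _ => 0 := by
      filter_upwards [notMem_tsupport_iff_eventuallyEq.1 fun h => hx (hχΩ h)] with y hy
      simp [hy]
    exact continuousAt_const.congr this.symm

lemma pderiv3_convolution {ρ v : R3 → ℝ} (hρ : ContDiff ℝ ∞ ρ) (hρc : HasCompactSupport ρ)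
    (hv : Continuous v) (i : Fin 3) (x : R3) :
    pderiv3 i (ρ ⋆[ContinuousLinearMap.lsmul ℝ ℝ, volume] v) x =
      ∫ y, v y * pderiv3 i ρ (x - y) := by
  have h1 : ContDiff ℝ 1 ρ := hρ.of_le (by exact_mod_cast le_top)
  have h := hρc.hasFDerivAt_convolution_right (ContinuousLinearMap.lsmul ℝ ℝ).flip
    (hv.locallyIntegrable (μ := volume)) h1 x
  rw [convolution_flip] at h
  rw [pderiv3, h.fderiv, convolution_precompR_apply _ (hv.locallyIntegrable (μ := volume))
    (hρc.fderiv ℝ) (h1.continuous_fderiv one_ne_zero)]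
  rw [convolution_def]
  refine integral_congr_ae (ae_of_all _ fun y => ?_)
  simp [pderiv3, mul_comm]

lemma pderiv3_neg_of_even {ρ : R3 → ℝ} (hρ : Differentiable ℝ ρ) (he : ∀ x, ρ (-x) = ρ x) (i : Fin 3) (x : R3) :
    pderiv3 i ρ (-x) = - pderiv3 i ρ x := by
  have h : fderiv ℝ (fun y => ρ (-y)) x = _ :=
    ((hρ (-x)).hasFDerivAt.comp x (hasFDerivAt_id x).neg).fderiv
  have h2 : (fun y => ρ (-y)) = ρ := funext he
  rw [h2] at h
  simp [pderiv3, h]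

/-- Duality of the derivative of a mollification. -/
lemma integral_mul_pderiv3_convolution {ρ v ψ : R3 → ℝ} (hρ : ContDiff ℝ ∞ ρ)
    (hρc : HasCompactSupport ρ) (he : ∀ x, ρ (-x) = ρ x) (hv : Continuous v)
    (hvc : HasCompactSupport v) (hψ : Continuous ψ) (hψc : HasCompactSupport ψ) (i : Fin 3) :
    ∫ x, ψ x * pderiv3 i (ρ ⋆[ContinuousLinearMap.lsmul ℝ ℝ, volume] v) x =
      - ∫ y, v y * pderiv3 i (ρ ⋆[ContinuousLinearMap.lsmul ℝ ℝ, volume] ψ) y := by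
  simp only [pderiv3_convolution hρ hρc hv, pderiv3_convolution hρ hρc hψ, ← integral_const_mul]
  rw [integral_integral_swap_of_hasCompactSupport, ← integral_neg]
  · refine integral_congr_ae (ae_of_all _ fun y => ?_)
    simp only [← integral_neg]
    refine integral_congr_ae (ae_of_all _ fun x => ?_)
    simp only
    rw [show x - y = -(y - x) by abel, pderiv3_neg_of_even (hρ.differentiable (by simp)) he]
    ring
  · have := (contDiff_pderiv3 hρ i).continuous
    simp only [Function.uncurry_def]
    fun_prop
  · refine HasCompactSupport.intro (hψc.isCompact.prod hvc.isCompact) fun p hp => ?_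
    simp only [Function.uncurry_def]
    by_cases h1 : p.1 ∈ tsupport ψ
    · have h2 : p.2 ∉ tsupport v := fun h2 => hp ⟨h1, h2⟩
      simp [image_eq_zero_of_notMem_tsupport h2]
    · simp [image_eq_zero_of_notMem_tsupport h1]

/-- Smooth approximations of a continuous function of bounded variation, on a compact set `K`. -/
theorem exists_contDiff_approx {Ω : Set R3} (hΩ : IsOpen Ω) {u : R3 → ℝ} (hu : ContinuousOn u Ω)
    {i : Fin 3} {μ : SignedMeasure R3} (hμ : IsDistribPartial Ω u i μ) {K : Set R3}
    (hK : IsCompact K) (hKΩ : K ⊆ Ω) :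
    ∃ v : ℕ → R3 → ℝ, (∀ m, ContDiff ℝ ∞ (v m)) ∧ TendstoUniformlyOn v u atTop K ∧
      ∀ (ψ : ℕ → R3 → ℝ) (ψ₀ : R3 → ℝ), (∀ m, Continuous (ψ m)) → (∀ m, ∀ x ∉ K, ψ m x = 0) →
        Continuous ψ₀ → (∀ x ∉ K, ψ₀ x = 0) → TendstoUniformly ψ ψ₀ atTop →
        Tendsto (fun m => ∫ x, ψ m x * pderiv3 i (v m) x) atTop (𝓝 (∫ᵛ x, ψ₀ x ∂<•μ)) := by
  obtain ⟨χ, hχ, hχc, hχΩ, hχ1⟩ := exists_contDiff_one_nhdsSet hK hΩ hKΩ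
  obtain ⟨W, hWo, hKW, hW⟩ := eventually_nhdsSet_iff_exists.1 hχ1
  -- Mollifying at scales at most `ε₀` keeps test functions supported in `K` inside `W`, where `χ =
  -- 1` and the truncation `χ u` equals `u`.
  obtain ⟨ε₀, hε₀, hthick⟩ := hK.exists_cthickening_subset_open hWo hKW
  set w : R3 → ℝ := fun x => χ x * u x with hw
  have hwcont : Continuous w := continuous_mul_of_tsupport_subset hΩ hχ.continuous hχΩ hu
  have hwc : HasCompactSupport w := hχc.mul_right
  set η : ℕ → ContDiffBump (0 : R3) := fun m =>
    ⟨ε₀ / (m + 2) / 2, ε₀ / (m + 2), by positivity, half_lt_self (by positivity)⟩ with hη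
  have hηle : ∀ m, (η m).rOut ≤ ε₀ := fun m => by
    simp only [hη]
    exact div_le_self hε₀.le (by have : (0 : ℝ) ≤ m := by positivity
                                 linarith)
  have hηlim : Tendsto (fun m => (η m).rOut) atTop (𝓝 0) := by
    simp only [hη]
    exact Tendsto.div_atTop tendsto_const_nhds
      (tendsto_atTop_add_const_right _ _ tendsto_natCast_atTop_atTop)
  set ρ : ℕ → R3 → ℝ := fun m => (η m).normed volume with hρ
  have hρsm : ∀ m, ContDiff ℝ ∞ (ρ m) := fun m => (η m).contDiff_normed
  have hρc : ∀ m, HasCompactSupport (ρ m) := fun m => (η m).hasCompactSupport_normed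
  refine ⟨fun m => ρ m ⋆[ContinuousLinearMap.lsmul ℝ ℝ, volume] w, fun m =>
    (hρc m).contDiff_convolution_left _ (hρsm m) hwcont.locallyIntegrable, ?_, ?_⟩
  · rw [Metric.tendstoUniformlyOn_iff]
    intro ε hε
    obtain ⟨δ, hδ, hunif⟩ := Metric.uniformContinuous_iff.1
      (hwc.uniformContinuous_of_continuous hwcont) (ε / 2) (half_pos hε)
    filter_upwards [hηlim.eventually (gt_mem_nhds hδ)] with m hm x hx
    have hwx : w x = u x := by simp [hw, hW x (hKW hx)]
    rw [dist_comm, ← hwx]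
    refine (ContDiffBump.dist_normed_convolution_le hwcont.aestronglyMeasurable
      (ε := ε / 2) fun y hy => ?_).trans_lt (half_lt_self hε)
    exact (hunif ((Metric.mem_ball.1 hy).trans hm)).le
  · intro ψ ψ₀ hψ hψK hψ₀ hψ₀K hlim
    have hψc : ∀ m, HasCompactSupport (ψ m) := fun m => HasCompactSupport.intro hK (hψK m)
    have hψ₀c : HasCompactSupport ψ₀ := HasCompactSupport.intro hK hψ₀K
    -- The even kernel can be moved onto `ψ m`, and `ρ m ⋆ ψ m` is an admissible test function in
    -- the definition of `D_i u`.
    have key : ∀ m, ∫ x, ψ m x * pderiv3 i (ρ m ⋆[ContinuousLinearMap.lsmul ℝ ℝ, volume] w) x =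
        ∫ᵛ x, (ρ m ⋆[ContinuousLinearMap.lsmul ℝ ℝ, volume] ψ m) x ∂<•μ := by
      intro m
      set θ := ρ m ⋆[ContinuousLinearMap.lsmul ℝ ℝ, volume] ψ m with hθ
      have hθsm : ContDiff ℝ ∞ θ :=
        (hρc m).contDiff_convolution_left _ (hρsm m) (hψ m).locallyIntegrable
      have hθz : ∀ x ∉ Metric.cthickening ε₀ K, θ x = 0 := by
        intro x hx
        have hz : ∀ y ∈ Metric.ball x (η m).rOut, ψ m y = 0 := fun y hy => hψK m y fun hyK =>
          hx (Metric.mem_cthickening_of_dist_le x y ε₀ K hyK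
            (by rw [dist_comm]; exact (Metric.mem_ball.1 hy).le.trans (hηle m)))
        have hx0 := hz x (Metric.mem_ball_self (η m).rOut_pos)
        have := ContDiffBump.normed_convolution_eq_right (μ := volume) (φ := η m) (g := ψ m)
          (x₀ := x) (fun y hy => by rw [hz y hy, hx0])
        rw [hθ, hρ]; simp only; rw [this, hx0]
      have hθt : tsupport θ ⊆ Metric.cthickening ε₀ K := by
        refine closure_minimal (fun x hx => ?_) Metric.isClosed_cthickening
        by_contra h
        exact hx (hθz x h)
      have hWΩ : Metric.cthickening ε₀ K ⊆ Ω := fun x hx => hχΩ <| subset_tsupport _ <| by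
        rw [Function.mem_support, hW x (hthick hx)]; exact one_ne_zero
      have hθc : HasCompactSupport θ := HasCompactSupport.intro hK.cthickening hθz
      have hpd : ∀ x ∉ Metric.cthickening ε₀ K, pderiv3 i θ x = 0 := by
        intro x hx
        have : fderiv ℝ θ x = 0 := image_eq_zero_of_notMem_tsupport fun h =>
          hx (hθt (tsupport_fderiv_subset ℝ h))
        simp [pderiv3, this]
      rw [integral_mul_pderiv3_convolution (hρsm m) (hρc m) (fun x => (η m).normed_neg x) hwcont
        hwc (hψ m) (hψc m), ← hθ, neg_eq_iff_eq_neg, ← hμ θ hθsm hθc (hθt.trans hWΩ),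
        ← setIntegral_eq_integral_of_forall_compl_eq_zero (s := Ω)]
      · refine setIntegral_congr_fun hΩ.measurableSet fun x hx => ?_
        by_cases hxK : x ∈ Metric.cthickening ε₀ K
        · simp [hw, hW x (hthick hxK), pderiv3]
        · have := hpd x hxK
          simp only [this, mul_zero]
          rw [pderiv3] at this
          rw [this, mul_zero]
      · intro x hx
        rw [hpd x fun h => hx (hWΩ h), mul_zero]
    simp only [key]
    obtain ⟨C, hC⟩ := hψ₀c.exists_bound_of_continuous hψ₀
    rw [Metric.tendstoUniformly_iff] at hlim
    refine VectorMeasure.tendsto_integral_filter_of_norm_le_const ?_ ⟨C + 1, ?_⟩ ?_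
    · exact Eventually.of_forall fun m => ((hρc m).contDiff_convolution_left _ (hρsm m)
        (hψ m).locallyIntegrable).continuous.aestronglyMeasurable
    · filter_upwards [hlim 1 one_pos] with m hm
      refine ae_of_all _ fun x => ?_
      rw [← dist_zero_right]
      have hC0 : 0 ≤ C := (norm_nonneg _).trans (hC 0)
      refine dist_convolution_le (by linarith) (η m).support_normed_eq.subset (η m).nonneg_normed
        (η m).integral_normed (hψ m).aestronglyMeasurable fun y _ => ?_
      have h1 := hm y
      have h2 := hC y
      rw [← dist_zero_right] at h2
      rw [dist_comm] at h1
      linarith [dist_triangle (ψ m y) (ψ₀ y) 0]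
    · refine ae_of_all _ fun x => ?_
      refine ContDiffBump.convolution_tendsto_right hηlim
        (Eventually.of_forall fun m => (hψ m).aestronglyMeasurable) ?_ tendsto_const_nhds
      rw [Metric.tendsto_nhds]
      intro ε hε
      have h1 := hlim (ε / 2) (half_pos hε)
      have h2 := Metric.tendsto_nhds.1 (hψ₀.tendsto x) (ε / 2) (half_pos hε)
      filter_upwards [h1.prod_mk h2] with p hp
      have := hp.1 p.2
      rw [dist_comm] at this
      simp only [Function.uncurry_def]
      linarith [dist_triangle (ψ p.1 p.2) (ψ₀ p.2) (ψ₀ x), hp.2]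

/-! ### The chain rule, and absolute continuity of the image of `D_3 u` -/

lemma continuousOn_graphMap {Ω : Set R3} {u : R3 → ℝ} (hu : ContinuousOn u Ω) :
    ContinuousOn (graphMap u) Ω := by
  have : graphMap u = fun x => x 0 • (EuclideanSpace.single 0 1 : R3) +
      x 1 • EuclideanSpace.single 1 1 + u x • EuclideanSpace.single 2 1 :=
    funext fun x => vec3_eq_sum _ _ _
  rw [this]
  fun_prop

lemma dist_graphMap (u v : R3 → ℝ) (x : R3) : dist (graphMap u x) (graphMap v x) =
    dist (u x) (v x) := by
  simp [EuclideanSpace.dist_eq, Fin.sum_univ_three, graphMap, Real.sqrt_sq dist_nonneg]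

lemma abs_primitive3_le {F : R3 → ℝ} {C : ℝ} (hC : ∀ y, |F y| ≤ C) (y : R3) :
    |primitive3 F y| ≤ C * |y 2| := by
  have := intervalIntegral.norm_integral_le_of_norm_le_const (a := 0) (b := y 2)
    (f := fun s => F !₂[y 0, y 1, s]) (C := C) fun s _ => hC _
  simpa [primitive3] using this

/-- Along the third axis only the last coordinate of the graph map moves, so `∂_3(G(x₁,x₂,v)) =
F(x₁,x₂,v) ∂_3 v`. As `F` is only continuous, `G` need not be differentiable in the other variables;
hence line derivatives. -/
lemma integral_mul_pderiv3_eq_neg_primitive3 {F φ v : R3 → ℝ} (hF : Continuous F)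
    (hφ : ContDiff ℝ ∞ φ) (hφc : HasCompactSupport φ) (hv : ContDiff ℝ ∞ v) :
    ∫ x, φ x * F (graphMap v x) * pderiv3 2 v x =
      - ∫ x, pderiv3 2 φ x * primitive3 F (graphMap v x) := by
  have hgc : Continuous (graphMap v) :=
    continuousOn_univ.1 (continuousOn_graphMap hv.continuous.continuousOn)
  have hφ1 : ContDiff ℝ 1 φ := hφ.of_le (by exact_mod_cast le_top)
  have hv1 : ContDiff ℝ 1 v := hv.of_le (by exact_mod_cast le_top)
  have hline : ∀ x, HasLineDerivAt ℝ (fun x => primitive3 F (graphMap v x))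
      (F (graphMap v x) * pderiv3 2 v x) x (EuclideanSpace.single 2 1) := by
    intro x
    have h1 : HasDerivAt (fun t : ℝ => v (x + t • EuclideanSpace.single 2 1)) (pderiv3 2 v x) 0 :=
      ((hv.differentiable (by simp)) x).hasFDerivAt.hasLineDerivAt _
    have h2 := (hasDerivAt_primitive3 hF (x 0) (x 1) (v x)).comp_of_eq (0 : ℝ) h1 (by simp)
    refine HasDerivAt.congr_of_eventuallyEq h2 (Eventually.of_forall fun t => ?_)
    simp [graphMap]
  have h := integral_bilinear_hasLineDerivAt_right_eq_neg_left_of_integrable (μ := volume)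
    (B := ContinuousLinearMap.mul ℝ ℝ) (f := φ) (f' := pderiv3 2 φ)
    (g := fun x => primitive3 F (graphMap v x)) (g' := fun x => F (graphMap v x) * pderiv3 2 v x)
    (v := EuclideanSpace.single 2 1) ?_ ?_ ?_
    (fun x _ => ((hφ.differentiable (by simp)) x).hasFDerivAt.hasLineDerivAt _)
    (fun x _ => hline x)
  · simpa [mul_assoc] using h
  · exact ((continuous_pderiv3 hφ1 2).mul ((continuous_primitive3 hF).comp hgc)
      ).integrable_of_hasCompactSupport (hasCompactSupport_pderiv3 hφc 2).mul_right
  · exact (hφ.continuous.mul ((hF.comp hgc).mul (continuous_pderiv3 hv1 2))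
      ).integrable_of_hasCompactSupport hφc.mul_right
  · exact (hφ.continuous.mul ((continuous_primitive3 hF).comp hgc)
      ).integrable_of_hasCompactSupport hφc.mul_right

lemma tendstoUniformly_mul_comp_graphMap {F φ u : R3 → ℝ} {v : ℕ → R3 → ℝ} {K : Set R3}
    (hF : UniformContinuous F) (hφ : Continuous φ) (hφc : HasCompactSupport φ)
    (hφK : ∀ x ∉ K, φ x = 0) (hv : TendstoUniformlyOn v u atTop K) :
    TendstoUniformly (fun m x => φ x * F (graphMap (v m) x)) (fun x => φ x * F (graphMap u x))
      atTop := by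
  obtain ⟨C, hC⟩ := hφc.exists_bound_of_continuous hφ
  have hC0 : 0 ≤ C := (norm_nonneg _).trans (hC 0)
  rw [Metric.tendstoUniformly_iff]
  intro ε hε
  obtain ⟨δ, hδ, hunif⟩ := Metric.uniformContinuous_iff.1 hF (ε / (C + 1)) (by positivity)
  filter_upwards [Metric.tendstoUniformlyOn_iff.1 hv δ hδ] with m hm x
  by_cases hx : x ∈ K
  · have h1 : dist (F (graphMap u x)) (F (graphMap (v m) x)) < ε / (C + 1) :=
      hunif (by rw [dist_graphMap]; exact hm x hx)
    rw [Real.dist_eq] at h1 ⊢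
    rw [← mul_sub, abs_mul]
    rw [lt_div_iff₀ (by positivity)] at h1
    have h2 := hC x
    rw [Real.norm_eq_abs] at h2
    nlinarith [abs_nonneg (F (graphMap u x) - F (graphMap (v m) x)), abs_nonneg (φ x)]
  · simpa [hφK x hx] using hε

/-- The chain rule `D_3 (G(x₁, x₂, u)) = F(x₁, x₂, u) D_3 u` for continuous `u` of bounded
variation, where `G(y) = ∫₀^{y₃} F(y₁, y₂, s) ds`. -/
theorem vectorIntegral_mul_comp_graphMap {Ω : Set R3} (hΩ : IsOpen Ω) {u : R3 → ℝ}
    (hu : ContinuousOn u Ω) {μ : SignedMeasure R3} (hμ : IsDistribPartial Ω u 2 μ)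
    {F φ : R3 → ℝ} (hF : UniformContinuous F) {C : ℝ} (hC : ∀ y, |F y| ≤ C)
    (hφ : ContDiff ℝ ∞ φ) (hφc : HasCompactSupport φ) (hφΩ : tsupport φ ⊆ Ω) :
    ∫ᵛ x, φ x * F (graphMap u x) ∂<•μ = - ∫ x, pderiv3 2 φ x * primitive3 F (graphMap u x) := by
  obtain ⟨v, hvsm, hvlim, hpair⟩ := exists_contDiff_approx hΩ hu hμ hφc.isCompact hφΩ
  have hφK : ∀ x ∉ tsupport φ, φ x = 0 := fun x hx => image_eq_zero_of_notMem_tsupport hx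
  have hφ1 : ContDiff ℝ 1 φ := hφ.of_le (by exact_mod_cast le_top)
  have hgc : ∀ m, Continuous (graphMap (v m)) := fun m =>
    continuousOn_univ.1 (continuousOn_graphMap (hvsm m).continuous.continuousOn)
  have h1 := hpair (fun m x => φ x * F (graphMap (v m) x)) (fun x => φ x * F (graphMap u x))
    (fun m => hφ.continuous.mul (hF.continuous.comp (hgc m)))
    (fun m x hx => by simp [hφK x hx])
    (continuous_mul_of_tsupport_subset hΩ hφ.continuous hφΩ
      (hF.continuous.comp_continuousOn (continuousOn_graphMap hu)))
    (fun x hx => by simp [hφK x hx])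
    (tendstoUniformly_mul_comp_graphMap hF hφ.continuous hφc hφK hvlim)
  simp only [integral_mul_pderiv3_eq_neg_primitive3 hF.continuous hφ hφc (hvsm _)] at h1
  refine tendsto_nhds_unique h1 (Tendsto.neg ?_)
  have hC0 : 0 ≤ C := (abs_nonneg _).trans (hC 0)
  obtain ⟨M, hM⟩ := hφc.isCompact.exists_bound_of_continuousOn (hu.mono hφΩ)
  have hpz : ∀ x ∉ tsupport φ, pderiv3 2 φ x = 0 := fun x hx => by
    have : fderiv ℝ φ x = 0 := image_eq_zero_of_notMem_tsupport fun h =>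
      hx (tsupport_fderiv_subset ℝ h)
    simp [pderiv3, this]
  -- The bound combines `|G(y)| ≤ C |y₃|` with `|v_m| ≤ M + 1` on the support of `φ` for large `m`.
  refine tendsto_integral_filter_of_dominated_convergence
    (fun x => |pderiv3 2 φ x| * (C * (M + 1))) ?_ ?_ ?_ ?_
  · exact Eventually.of_forall fun m => ((continuous_pderiv3 hφ1 2).mul
      ((continuous_primitive3 hF.continuous).comp (hgc m))).aestronglyMeasurable
  · filter_upwards [Metric.tendstoUniformlyOn_iff.1 hvlim 1 one_pos] with m hm
    refine ae_of_all _ fun x => ?_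
    by_cases hx : x ∈ tsupport φ
    · rw [norm_mul, Real.norm_eq_abs, Real.norm_eq_abs]
      refine mul_le_mul_of_nonneg_left ((abs_primitive3_le hC _).trans
        (mul_le_mul_of_nonneg_left ?_ hC0)) (abs_nonneg _)
      have h2 := hm x hx
      have h3 := hM x hx
      rw [dist_comm, Real.dist_eq] at h2
      rw [Real.norm_eq_abs] at h3
      have h4 : |v m x| ≤ |v m x - u x| + |u x| := by
        simpa using abs_add_le (v m x - u x) (u x)
      simp only [graphMap]
      change |v m x| ≤ M + 1
      linarith
    · simp [hpz x hx]
  · exact ((continuous_pderiv3 hφ1 2).abs.integrable_of_hasCompactSupport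
      ((hasCompactSupport_pderiv3 hφc 2).norm)).mul_const _
  · refine ae_of_all _ fun x => ?_
    by_cases hx : x ∈ tsupport φ
    · refine Tendsto.const_mul _ (((continuous_primitive3 hF.continuous).tendsto _).comp ?_)
      rw [tendsto_iff_dist_tendsto_zero]
      simp only [dist_graphMap]
      rw [← tendsto_iff_dist_tendsto_zero]
      exact hvlim.tendsto_at hx
    · simp [hpz x hx]

/-- Every translate of `N` along the third axis is null. Fubini for the pair (translation, point)
then gives `x + t e ∉ N` for a.e. `x` and a.e. `t`, and the substitution `s = x₃ + t` finishes. -/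
lemma ae_ae_notMem_of_volume_eq_zero {N : Set R3} (hN : MeasurableSet N) (h0 : volume N = 0) :
    ∀ᵐ x : R3, ∀ᵐ s : ℝ, (!₂[x 0, x 1, s] : R3) ∉ N := by
  set e : R3 := EuclideanSpace.single 2 1
  have hmeas : Measurable fun p : R3 × ℝ => p.1 + p.2 • e := by fun_prop
  have hae : ∀ᵐ p : ℝ × R3 ∂(volume.prod volume), p.2 + p.1 • e ∉ N := by
    rw [Measure.ae_prod_iff_ae_ae]
    · refine ae_of_all _ fun t => ?_
      rw [ae_iff]
      simp only [not_not]
      have := measure_preimage_add_right volume (t • e) N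
      rw [h0] at this
      exact this
    · exact ((hmeas.comp measurable_swap) hN).compl
  have hae' : ∀ᵐ x : R3, ∀ᵐ t : ℝ, x + t • e ∉ N := by
    have h1 : ∀ᵐ p : R3 × ℝ ∂(volume.prod volume), p.1 + p.2 • e ∉ N :=
      (Measure.measurePreserving_swap (μ := (volume : Measure R3)) (ν := (volume : Measure ℝ))
        ).quasiMeasurePreserving.ae hae
    exact Measure.ae_ae_of_ae_prod h1
  filter_upwards [hae'] with x hx
  have := (measurePreserving_add_right (volume : Measure ℝ) (-(x 2))).quasiMeasurePreserving.ae hx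
  filter_upwards [this] with s hs
  convert hs using 2
  ext i
  fin_cases i <;> simp [e]

/-- Take `θ ≥ 0` smooth and nonzero exactly on `V`. A smooth step function of `k θ` equals `1` as
soon as `k θ ≥ 1`. -/
lemma exists_contDiff_tendsto_indicator {E : Type*} [NormedAddCommGroup E] [NormedSpace ℝ E]
    [FiniteDimensional ℝ E] {V : Set E} (hV : IsOpen V) :
    ∃ φ : ℕ → E → ℝ, (∀ k, ContDiff ℝ ∞ (φ k)) ∧ (∀ k x, |φ k x| ≤ 1) ∧
      (∀ k, ∀ x ∉ V, φ k x = 0) ∧ ∀ x, Tendsto (fun k => φ k x) atTop (𝓝 (V.indicator 1 x)) := by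
  obtain ⟨θ, hθs, hθ, hθ01⟩ := hV.exists_contDiff_support_eq (n := ⊤)
  have hz : ∀ x ∉ V, θ x = 0 := fun x hx => by
    rw [← hθs] at hx
    simpa using hx
  refine ⟨fun k x => Real.smoothTransition (k * θ x), fun k => ?_, fun k x => ?_, fun k x hx => ?_,
    fun x => ?_⟩
  · exact Real.smoothTransition.contDiff.comp (contDiff_const.mul hθ)
  · rw [abs_of_nonneg (Real.smoothTransition.nonneg _)]
    exact Real.smoothTransition.le_one _
  · simp [hz x hx]
  · by_cases hx : x ∈ V
    · have hpos : 0 < θ x := by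
        have h1 : θ x ≠ 0 := by
          rw [← hθs] at hx
          exact hx
        exact lt_of_le_of_ne (hθ01 ⟨x, rfl⟩).1 h1.symm
      refine tendsto_const_nhds.congr' ?_
      obtain ⟨k₀, hk₀⟩ := exists_nat_ge (1 / θ x)
      filter_upwards [eventually_ge_atTop k₀] with k hk
      rw [Set.indicator_of_mem hx, Pi.one_apply, Real.smoothTransition.one_of_one_le]
      rw [div_le_iff₀ hpos] at hk₀
      exact hk₀.trans (mul_le_mul_of_nonneg_right (by exact_mod_cast hk) hpos.le)
    · simp [hz x hx, hx]

lemma measurableSet_inter_preimage_of_continuousOn {g : R3 → R3} {U A : Set R3}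
    (hg : ContinuousOn g U) (hU : MeasurableSet U) (hA : MeasurableSet A) :
    MeasurableSet (U ∩ g ⁻¹' A) := by
  have h := (continuousOn_iff_continuous_domRestrict.1 hg).measurable hA
  have h2 := hU.subtype_image h
  convert h2 using 1
  ext x
  simp [and_comm]

/-- The measure `D_3 u` does not charge the preimage of a closed null set under `h`. -/
theorem apply_inter_preimage_graphMap_eq_zero {Ω : Set R3} (hΩ : IsOpen Ω) {u : R3 → ℝ}
    (hu : ContinuousOn u Ω) {μ : SignedMeasure R3} (hμ : IsDistribPartial Ω u 2 μ)
    {U : Set R3} (hU : IsOpen U) (hUc : IsCompact (closure U)) (hUΩ : closure U ⊆ Ω)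
    {N : Set R3} (hN : IsClosed N) (h0 : volume N = 0) :
    μ (U ∩ graphMap u ⁻¹' N) = 0 := by
  set δ : ℕ → ℝ := fun k => 1 / ((k : ℝ) + 1) with hδ
  have hδpos : ∀ k, 0 < δ k := fun k => by simp only [hδ]; positivity
  have hδlim : Tendsto δ atTop (𝓝 0) := tendsto_one_div_add_atTop_nhds_zero_nat
  set F : ℕ → R3 → ℝ := fun k y => (thickenedIndicator (hδpos k) N y : ℝ) with hFdef
  have hFunif : ∀ k, UniformContinuous (F k) := fun k =>
    NNReal.isometry_coe.uniformContinuous.comp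
      (lipschitzWith_thickenedIndicator (hδpos k) N).uniformContinuous
  have hF1 : ∀ k y, |F k y| ≤ 1 := fun k y => by
    simp only [hFdef, NNReal.abs_eq]
    exact_mod_cast thickenedIndicator_le_one (hδpos k) N y
  have hFlim : ∀ y, Tendsto (fun k => F k y) atTop (𝓝 (N.indicator 1 y)) := by
    intro y
    have := tendsto_pi_nhds.1 (thickenedIndicator_tendsto_indicator_closure hδpos hδlim N) y
    rw [hN.closure_eq] at this
    have h2 := (NNReal.continuous_coe.tendsto _).comp this
    have h3 : ((N.indicator (fun _ => (1 : NNReal)) y : NNReal) : ℝ) = N.indicator 1 y := by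
      by_cases hy : y ∈ N <;> simp [hy]
    rw [h3] at h2
    exact h2
  -- The limit is the integral of the indicator of `N` along a vertical segment, zero for a.e. `x`.
  have hprim : ∀ᵐ x : R3, Tendsto (fun k => primitive3 (F k) (graphMap u x)) atTop (𝓝 0) := by
    filter_upwards [ae_ae_notMem_of_volume_eq_zero hN.measurableSet h0] with x hx
    have hlim : Tendsto (fun k => ∫ s in (0 : ℝ)..u x, F k !₂[x 0, x 1, s]) atTop
        (𝓝 (∫ s in (0 : ℝ)..u x, N.indicator 1 (!₂[x 0, x 1, s] : R3))) := by
      refine intervalIntegral.tendsto_integral_filter_of_dominated_convergence (fun _ => 1) ?_ ?_ ?_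
        ?_
      · exact Eventually.of_forall fun k => ((hFunif k).continuous.comp
          (continuous_vec3 continuous_const continuous_const continuous_id)).aestronglyMeasurable
      · exact Eventually.of_forall fun k => ae_of_all _ fun s _ => hF1 k _
      · exact intervalIntegrable_const
      · exact ae_of_all _ fun s _ => hFlim _
    have hzero : ∫ s in (0 : ℝ)..u x, N.indicator (1 : R3 → ℝ) (!₂[x 0, x 1, s] : R3) = 0 := by
      rw [intervalIntegral.integral_congr_ae (g := fun _ => (0 : ℝ))]
      · simp
      · filter_upwards [hx] with s hs _
        simp [hs]
    rw [hzero] at hlim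
    exact hlim
  -- Both sides of the chain rule for `F k` pass to the limit; the Lebesgue side tends to zero.
  have hφN : ∀ φ : R3 → ℝ, ContDiff ℝ ∞ φ → HasCompactSupport φ → tsupport φ ⊆ Ω →
      ∫ᵛ x, φ x * N.indicator 1 (graphMap u x) ∂<•μ = 0 := by
    intro φ hφ hφc hφΩ
    have hφ1 : ContDiff ℝ 1 φ := hφ.of_le (by exact_mod_cast le_top)
    obtain ⟨C, hC⟩ := hφc.exists_bound_of_continuous hφ.continuous
    have hpt : tsupport (pderiv3 2 φ) ⊆ tsupport φ := by
      refine closure_minimal (fun x hx => ?_) (isClosed_tsupport φ)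
      by_contra hxn
      have : fderiv ℝ φ x = 0 := image_eq_zero_of_notMem_tsupport fun h =>
        hxn (tsupport_fderiv_subset ℝ h)
      exact hx (by simp [pderiv3, this])
    have hl : Tendsto (fun k => ∫ᵛ x, φ x * F k (graphMap u x) ∂<•μ) atTop
        (𝓝 (∫ᵛ x, φ x * N.indicator 1 (graphMap u x) ∂<•μ)) := by
      refine VectorMeasure.tendsto_integral_filter_of_norm_le_const ?_ ⟨C, ?_⟩ ?_
      · exact Eventually.of_forall fun k => (continuous_mul_of_tsupport_subset hΩ hφ.continuous
          hφΩ ((hFunif k).continuous.comp_continuousOn (continuousOn_graphMap hu))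
          ).aestronglyMeasurable
      · refine Eventually.of_forall fun k => ae_of_all _ fun x => ?_
        rw [norm_mul]
        exact (mul_le_of_le_one_right (norm_nonneg _) (hF1 k _)).trans (hC x)
      · exact ae_of_all _ fun x => (hFlim _).const_mul _
    have hr : Tendsto (fun k => ∫ x, pderiv3 2 φ x * primitive3 (F k) (graphMap u x)) atTop
        (𝓝 (∫ _ : R3, (0 : ℝ))) := by
      refine tendsto_integral_filter_of_dominated_convergence
        (fun x => |pderiv3 2 φ x * u x|) ?_ ?_ ?_ ?_
      · exact Eventually.of_forall fun k => (continuous_mul_of_tsupport_subset hΩ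
          (continuous_pderiv3 hφ1 2) (hpt.trans hφΩ)
          ((continuous_primitive3 (hFunif k).continuous).comp_continuousOn
            (continuousOn_graphMap hu))).aestronglyMeasurable
      · refine Eventually.of_forall fun k => ae_of_all _ fun x => ?_
        rw [norm_mul, abs_mul]
        refine mul_le_mul_of_nonneg_left ?_ (abs_nonneg _)
        simpa [graphMap] using abs_primitive3_le (hF1 k) (graphMap u x)
      · exact ((continuous_mul_of_tsupport_subset hΩ (continuous_pderiv3 hφ1 2) (hpt.trans hφΩ)
          hu).integrable_of_hasCompactSupport (hasCompactSupport_pderiv3 hφc 2).mul_right).abs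
      · filter_upwards [hprim] with x hx
        simpa using hx.const_mul (pderiv3 2 φ x)
    simp only [vectorIntegral_mul_comp_graphMap hΩ hu hμ (hFunif _) (hF1 _) hφ hφc hφΩ] at hl
    have := tendsto_nhds_unique hl hr.neg
    simpa using this
  obtain ⟨φ, hφ, hφ1, hφz, hφlim⟩ := exists_contDiff_tendsto_indicator hU
  have hmeas : MeasurableSet (U ∩ graphMap u ⁻¹' N) :=
    measurableSet_inter_preimage_of_continuousOn
      ((continuousOn_graphMap hu).mono (subset_closure.trans hUΩ)) hU.measurableSet
      hN.measurableSet
  have hφU : ∀ k, tsupport (φ k) ⊆ closure U := fun k => closure_mono fun x hx => by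
    by_contra h
    exact hx (hφz k x h)
  have hlim : Tendsto (fun k => ∫ᵛ x, φ k x * N.indicator 1 (graphMap u x) ∂<•μ) atTop
      (𝓝 (∫ᵛ x, (U ∩ graphMap u ⁻¹' N).indicator (fun _ => (1 : ℝ)) x ∂<•μ)) := by
    refine VectorMeasure.tendsto_integral_filter_of_norm_le_const ?_ ⟨1, ?_⟩ ?_
    · refine Eventually.of_forall fun k => ?_
      have : (fun x => φ k x * N.indicator 1 (graphMap u x)) =
          fun x => φ k x * (U ∩ graphMap u ⁻¹' N).indicator (fun _ => (1 : ℝ)) x := by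
        funext x
        by_cases hx : x ∈ U
        · by_cases hxN : graphMap u x ∈ N <;> simp [hx, hxN]
        · simp [hφz k x hx]
      rw [this]
      exact ((hφ k).continuous.measurable.mul
        (measurable_const.indicator hmeas)).aestronglyMeasurable
    · refine Eventually.of_forall fun k => ae_of_all _ fun x => ?_
      rw [norm_mul]
      refine mul_le_one₀ (hφ1 k x) (norm_nonneg _) ?_
      by_cases hxN : graphMap u x ∈ N <;> simp [hxN]
    · refine ae_of_all _ fun x => ?_
      have h1 := (hφlim x).mul_const (N.indicator (1 : R3 → ℝ) (graphMap u x))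
      convert h1 using 2
      by_cases hx : x ∈ U <;> by_cases hxN : graphMap u x ∈ N <;> simp [hx, hxN]
  have hz : ∀ k, ∫ᵛ x, φ k x * N.indicator 1 (graphMap u x) ∂<•μ = 0 := fun k =>
    hφN (φ k) (hφ k) (HasCompactSupport.intro hUc fun x hx => hφz k x fun h => hx (subset_closure h))
      ((hφU k).trans hUΩ)
  simp only [hz] at hlim
  have h1 := tendsto_nhds_unique hlim tendsto_const_nhds
  rw [VectorMeasure.integral_indicator_const _ hmeas] at h1
  simpa using h1

/-! ### The Brouwer degree of `h` -/

lemma pderiv3_coord (i j : Fin 3) (x : R3) :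
    pderiv3 i (fun y => y j) x = if j = i then 1 else 0 := by
  have h : HasFDerivAt (fun y : R3 => y j) (EuclideanSpace.proj j : R3 →L[ℝ] ℝ) x :=
    (EuclideanSpace.proj j : R3 →L[ℝ] ℝ).hasFDerivAt
  rw [pderiv3, h.fderiv]
  simp

lemma contDiff_graphMap {v : R3 → ℝ} (hv : ContDiff ℝ ∞ v) : ContDiff ℝ ∞ (graphMap v) :=
  contDiff_vec3 (a := fun x => x 0) (b := fun x => x 1) (by fun_prop) (by fun_prop) hv

/-- The first two rows of the Jacobian matrix are those of the identity. This is the link between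
`D_3u` and the degree. -/
lemma det_fderiv_graphMap {v : R3 → ℝ} (hv : ContDiff ℝ ∞ v) (x : R3) :
    (fderiv ℝ (graphMap v) x).det = pderiv3 2 v x := by
  have h := det_fderiv_vec3 (a := fun x => x 0) (b := fun x => x 1) (c := v) (x := x)
    (by fun_prop) (by fun_prop) (hv.differentiable (by simp) x)
  refine h.trans ?_
  simp [jac, pderiv3_coord]

/-- Near a point `z₀` at which `h` has degree `d`, the image of `D_3 u` under `h` has density
`d` (tested against smooth functions). -/
theorem exists_vectorIntegral_comp_graphMap_eq {Ω : Set R3} (hΩ : IsOpen Ω) {u : R3 → ℝ}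
    (hu : ContinuousOn u Ω) {μ : SignedMeasure R3} (hμ : IsDistribPartial Ω u 2 μ)
    {U : Set R3} (hU : IsOpen U) (hUne : U.Nonempty) (hUc : IsCompact (closure U))
    (hUΩ : closure U ⊆ Ω) {z₀ : R3} {d : ℤ} (hd : IsBrouwerDegree (graphMap u) U z₀ d) :
    ∃ r > 0, ∀ f : R3 → ℝ, ContDiff ℝ ∞ f → (∀ z ∉ Metric.ball z₀ r, f z = 0) →
      ∫ᵛ x, U.indicator (fun x => f (graphMap u x)) x ∂<•μ = d * ∫ z, f z := by
  obtain ⟨g, hg, hclose, hreg, rfl⟩ := hd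
  set δ := Metric.infDist z₀ (graphMap u '' frontier U) with hδ
  have hhc : ContinuousOn (graphMap u) (closure U) := (continuousOn_graphMap hu).mono hUΩ
  have hfront : ∀ x ∈ frontier U, δ ≤ dist (graphMap u x) z₀ := fun x hx => by
    rw [dist_comm]
    exact Metric.infDist_le_dist_of_mem (mem_image_of_mem _ hx)
  obtain ⟨δ', hδ'0, hδ'δ, hgh⟩ : ∃ δ', 0 ≤ δ' ∧ δ' < δ ∧
      ∀ x ∈ closure U, dist (graphMap u x) (g x) ≤ δ' := by
    obtain ⟨x, hx, hmax⟩ := hUc.exists_isMaxOn hUne.closure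
      (continuous_dist.comp_continuousOn (hhc.prodMk hg.continuous.continuousOn))
    exact ⟨_, dist_nonneg, hclose x hx, fun y hy => hmax hy⟩
  -- Compactness leaves a margin `4ε` between `sup |h - g|` and `dist(z₀, h(∂U))`. Three units are
  -- spent below: `|v_m - u| < ε`, the tolerance `ε` around the segment, and the radius of the
  -- support of `f`. The fourth keeps `K₀` off `∂U`.
  set ε := (δ - δ') / 4 with hε
  have hεpos : 0 < ε := by simp only [hε]; linarith
  set K₀ := closure U ∩ graphMap u ⁻¹' Metric.closedBall z₀ (δ' + 3 * ε) with hK₀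
  have hK₀c : IsCompact K₀ :=
    hUc.of_isClosed_subset (hhc.preimage_isClosed_of_isClosed isClosed_closure
      Metric.isClosed_closedBall) inter_subset_left
  have hK₀U : K₀ ⊆ U := by
    intro x hx
    by_contra hxU
    have h1 := hfront x (by rw [hU.frontier_eq]; exact ⟨hx.1, hxU⟩)
    have h2 : dist (graphMap u x) z₀ ≤ δ' + 3 * ε := hx.2
    simp only [hε] at h2
    linarith
  obtain ⟨φ, hφ, hφc, hφU, hφ1⟩ := exists_contDiff_one_nhdsSet hK₀c hU hK₀U
  have hφK₀ : ∀ x ∈ K₀, φ x = 1 := fun x hx => hφ1.self_of_nhdsSet x hx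
  have hφz : ∀ x ∉ U, φ x = 0 := fun x hx => image_eq_zero_of_notMem_tsupport fun h => hx (hφU h)
  have hφd : ∀ x, fderiv ℝ φ x ≠ 0 → x ∈ closure U ∧ x ∉ K₀ := by
    intro x hx
    constructor
    · by_contra h
      exact hx (image_eq_zero_of_notMem_tsupport fun h' =>
        h (subset_closure (hφU (tsupport_fderiv_subset ℝ h'))))
    · intro h
      have : φ =ᶠ[𝓝 x] fun _ => 1 := eventually_nhdsSet_iff_forall.1 hφ1 x h
      exact hx (by rw [this.fderiv_eq]; simp)
  have hgfront : z₀ ∉ g '' frontier U := by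
    rintro ⟨x, hx, hxz⟩
    have h1 := hclose x (frontier_subset_closure hx)
    rw [hxz] at h1
    exact absurd (hfront x hx) (not_le.2 h1)
  obtain ⟨r₁, hr₁, hdeg⟩ := exists_integral_mul_det_eq_regularDegree_mul hg hU hUc hgfront hreg
  refine ⟨min r₁ ε, lt_min hr₁ hεpos, fun f hf hfz => ?_⟩
  have hfball : ∀ z, f z ≠ 0 → dist z z₀ < min r₁ ε := fun z hz => by
    by_contra h
    exact hz (hfz z h)
  rw [← hdeg f hf.continuous fun z hz => by
    by_contra h
    exact hz ((hfball z h).trans_le (min_le_left _ _))]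
  have hUφ : ∫ x in U, f (g x) * (fderiv ℝ g x).det =
      ∫ x, φ x * (f (g x) * (fderiv ℝ g x).det) := by
    rw [← setIntegral_eq_integral_of_forall_compl_eq_zero (s := U)
      (f := fun x => φ x * (f (g x) * (fderiv ℝ g x).det))
      (fun x hx => by rw [hφz x hx, zero_mul])]
    refine setIntegral_congr_fun hU.measurableSet fun x hx => ?_
    by_cases hfx : f (g x) = 0
    · simp [hfx]
    · have hxK : x ∈ K₀ := by
        refine ⟨subset_closure hx, ?_⟩
        have h1 := (hfball _ hfx).trans_le (min_le_right _ _)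
        have h2 := hgh x (subset_closure hx)
        rw [mem_preimage, Metric.mem_closedBall]
        linarith [dist_triangle (graphMap u x) (g x) z₀]
      simp [hφK₀ x hxK]
  obtain ⟨v, hvsm, hvlim, hpair⟩ := exists_contDiff_approx hΩ hu hμ hUc hUΩ
  have hφz' : ∀ x ∉ closure U, φ x = 0 := fun x hx => hφz x fun h => hx (subset_closure h)
  have hfc : HasCompactSupport f := HasCompactSupport.intro (isCompact_closedBall z₀ (min r₁ ε))
    fun z hz => hfz z fun h => hz (Metric.ball_subset_closedBall h)
  have hfu : UniformContinuous f := hfc.uniformContinuous_of_continuous hf.continuous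
  have hlim := hpair (fun m x => φ x * f (graphMap (v m) x)) (fun x => φ x * f (graphMap u x))
    (fun m => hφ.continuous.mul (hf.continuous.comp (contDiff_graphMap (hvsm m)).continuous))
    (fun m x hx => by simp [hφz' x hx])
    (continuous_mul_of_tsupport_subset hΩ hφ.continuous (hφU.trans (subset_closure.trans hUΩ))
      (hf.continuous.comp_continuousOn (continuousOn_graphMap hu)))
    (fun x hx => by simp [hφz' x hx])
    (tendstoUniformly_mul_comp_graphMap hfu hφ.continuous hφc hφz' hvlim)
  -- Where `∇φ ≠ 0` the point lies outside `K₀`, so the segment from `g` to the mollified map stays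
  -- away from the support of `f`: the sequence is eventually constant.
  have hconst : ∀ᶠ m in atTop, ∫ x, φ x * f (graphMap (v m) x) * pderiv3 2 (v m) x =
      ∫ x, φ x * (f (g x) * (fderiv ℝ g x).det) := by
    filter_upwards [Metric.tendstoUniformlyOn_iff.1 hvlim ε hεpos] with m hm
    rw [integral_mul_det_eq_of_homotopy hφ hφc hf hg (contDiff_graphMap (hvsm m)) hεpos]
    · simp only [det_fderiv_graphMap (hvsm m), mul_assoc]
    · intro x hx t ht y hy
      obtain ⟨hxU, hxK⟩ := hφd x hx
      by_contra hfy
      refine hxK ⟨hxU, ?_⟩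
      have h1 := (hfball _ hfy).trans_le (min_le_right _ _)
      have h2 : g x + t • (graphMap (v m) x - g x) ∈
          Metric.closedBall (graphMap u x) (δ' + ε) := by
        refine (convex_closedBall _ _).add_smul_sub_mem ?_ ?_ ht
        · rw [Metric.mem_closedBall, dist_comm]
          linarith [hgh x hxU]
        · rw [Metric.mem_closedBall, dist_comm, dist_graphMap]
          linarith [hm x hxU]
      rw [Metric.mem_closedBall, dist_comm] at h2
      rw [mem_preimage, Metric.mem_closedBall]
      rw [dist_comm] at hy
      linarith [dist_triangle4 (graphMap u x) (g x + t • (graphMap (v m) x - g x)) y z₀]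
  have heq := tendsto_nhds_unique (hlim.congr' hconst) tendsto_const_nhds
  rw [hUφ, ← heq]
  congr 1
  funext x
  by_cases hx : x ∈ U
  · rw [indicator_of_mem hx]
    by_cases hfx : f (graphMap u x) = 0
    · simp [hfx]
    · have hxK : x ∈ K₀ := by
        refine ⟨subset_closure hx, ?_⟩
        have h1 := (hfball _ hfx).trans_le (min_le_right _ _)
        rw [mem_preimage, Metric.mem_closedBall]
        linarith
      simp [hφK₀ x hxK]
  · simp [hx, hφz x hx]

/-- `Metric.infDist` to the empty set is `0`, so a positive distance to `h(∂U)` requires `∂U` to be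
nonempty. -/
lemma frontier_nonempty_of_isCompact_closure {U : Set R3} (hUne : U.Nonempty)
    (hUc : IsCompact (closure U)) : (frontier U).Nonempty := by
  rw [nonempty_frontier_iff]
  refine ⟨hUne, fun h => ?_⟩
  rw [h, closure_univ] at hUc
  exact noncompact_univ R3 hUc

/-- Existence of the degree of `h` at the points of `ℝ³ \ h(∂U)`. -/
theorem exists_isBrouwerDegree_graphMap {Ω : Set R3} (hΩ : IsOpen Ω) {u : R3 → ℝ}
    (hu : ContinuousOn u Ω) {μ : SignedMeasure R3} (hμ : IsDistribPartial Ω u 2 μ)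
    {U : Set R3} (hUne : U.Nonempty) (hUc : IsCompact (closure U))
    (hUΩ : closure U ⊆ Ω) {z₀ : R3} (hz₀ : z₀ ∉ graphMap u '' frontier U) :
    ∃ d, IsBrouwerDegree (graphMap u) U z₀ d := by
  have hN : IsCompact (graphMap u '' frontier U) :=
    (hUc.of_isClosed_subset isClosed_frontier frontier_subset_closure).image_of_continuousOn
      ((continuousOn_graphMap hu).mono (frontier_subset_closure.trans hUΩ))
  have hδ := (hN.isClosed.notMem_iff_infDist_pos
    ((frontier_nonempty_of_isCompact_closure hUne hUc).image _)).1 hz₀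
  set δ := Metric.infDist z₀ (graphMap u '' frontier U)
  obtain ⟨v, hvsm, hvlim, -⟩ := exists_contDiff_approx hΩ hu hμ hUc hUΩ
  obtain ⟨m, hm⟩ := (Metric.tendstoUniformlyOn_iff.1 hvlim (δ / 2) (half_pos hδ)).exists
  have hk := contDiff_graphMap (hvsm m)
  set k := graphMap (v m)
  -- By Sard, some regular value `z'` of `k` lies within `δ/2` of `z₀`; translating `k` by `z₀ - z'`
  -- makes `z₀` regular.
  have hsard : volume (k '' {x | (fderiv ℝ k x).det = 0}) = 0 :=
    addHaar_image_eq_zero_of_det_fderivWithin_eq_zero volume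
      (fun x _ => ((hk.differentiable (by simp)) x).hasFDerivAt.hasFDerivWithinAt) fun x hx => hx
  obtain ⟨z', hz', hz'reg⟩ : ∃ z' ∈ Metric.ball z₀ (δ / 2),
      z' ∉ k '' {x | (fderiv ℝ k x).det = 0} := by
    by_contra! h
    exact (Metric.measure_ball_pos volume z₀ (half_pos hδ)).ne' (measure_mono_null h hsard)
  refine ⟨_, fun x => k x + (z₀ - z'), hk.add contDiff_const, fun x hx => ?_, fun x _ hxz => ?_, rfl⟩
  · have h1 := hm x hx
    rw [← dist_graphMap u (v m)] at h1
    have h2 : dist (k x) (k x + (z₀ - z')) < δ / 2 := by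
      rw [dist_self_add_right, ← dist_eq_norm, dist_comm]
      exact hz'
    calc dist (graphMap u x) (k x + (z₀ - z')) ≤ dist (graphMap u x) (k x) +
          dist (k x) (k x + (z₀ - z')) := dist_triangle _ _ _
      _ < δ := by linarith
  · rw [fderiv_add_const]
    intro h0
    refine hz'reg ⟨x, h0, ?_⟩
    have hxz' : k x + (z₀ - z') = z₀ := hxz
    exact (eq_sub_of_add_eq hxz').trans (sub_sub_cancel z₀ z')

/-! ### The image measure and its local density. -/

/-- The image of the restriction of `μ` to `U` under `h`. -/
noncomputable def graphImage (μ : SignedMeasure R3) (U : Set R3) (u : R3 → ℝ) : SignedMeasure R3 :=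
  (μ.restrict U).map (graphMap (U.indicator u))

/-- Extending `u` by zero makes the map measurable on the whole space, and the restricted measure
sees only `U`, where nothing has changed. -/
lemma graphImage_apply {μ : SignedMeasure R3} {U : Set R3} {u : R3 → ℝ} (hU : MeasurableSet U)
    (hu : ContinuousOn u U) {A : Set R3} (hA : MeasurableSet A) :
    graphImage μ U u A = μ (U ∩ graphMap u ⁻¹' A) := by
  have hmeas : Measurable (U.indicator u) := by
    classical
    rw [← piecewise_eq_indicator]
    exact hu.measurable_piecewise continuousOn_const hU
  have hgm : Measurable (graphMap (U.indicator u)) := by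
    have : graphMap (U.indicator u) = fun x => x 0 • (EuclideanSpace.single 0 1 : R3) +
        x 1 • EuclideanSpace.single 1 1 + U.indicator u x • EuclideanSpace.single 2 1 :=
      funext fun x => vec3_eq_sum _ _ _
    rw [this]
    fun_prop
  rw [graphImage, VectorMeasure.map_apply _ hgm hA, VectorMeasure.restrict_apply _ hU (hgm hA)]
  congr 1
  ext x
  simp only [mem_inter_iff, mem_preimage]
  constructor
  · rintro ⟨h1, h2⟩
    exact ⟨h2, by simpa [graphMap, h2] using h1⟩
  · rintro ⟨h1, h2⟩
    exact ⟨by simpa [graphMap, h1] using h2, h1⟩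

lemma vectorIntegral_indicator_comp_tendsto {μ : SignedMeasure R3} {U V : Set R3} {u : R3 → ℝ}
    (hU : MeasurableSet U) (hu : ContinuousOn u U) (hV : MeasurableSet V) {f : ℕ → R3 → ℝ}
    (hf : ∀ k, Continuous (f k)) (hf1 : ∀ k x, |f k x| ≤ 1)
    (hlim : ∀ x, Tendsto (fun k => f k x) atTop (𝓝 (V.indicator 1 x))) :
    Tendsto (fun k => ∫ᵛ x, U.indicator (fun x => f k (graphMap u x)) x ∂<•μ) atTop
      (𝓝 (graphImage μ U u V)) := by
  have hgc : ContinuousOn (graphMap u) U := continuousOn_graphMap hu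
  have hm := measurableSet_inter_preimage_of_continuousOn hgc hU hV
  have h1 : ∫ᵛ x, (U ∩ graphMap u ⁻¹' V).indicator (fun _ => (1 : ℝ)) x ∂<•μ =
      graphImage μ U u V := by
    rw [VectorMeasure.integral_indicator_const _ hm, graphImage_apply hU hu hV]
    simp
  rw [← h1]
  refine VectorMeasure.tendsto_integral_filter_of_norm_le_const ?_ ⟨1, ?_⟩ ?_
  · exact Eventually.of_forall fun k => (aestronglyMeasurable_indicator_iff hU).2
      (((hf k).comp_continuousOn hgc).aestronglyMeasurable hU)
  · refine Eventually.of_forall fun k => ae_of_all _ fun x => ?_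
    by_cases hx : x ∈ U
    · simpa [hx] using hf1 k _
    · simp [hx]
  · refine ae_of_all _ fun x => ?_
    by_cases hx : x ∈ U
    · have := hlim (graphMap u x)
      by_cases hxV : graphMap u x ∈ V <;> simpa [hx, hxV] using this
    · simp [hx]

/-- Near a point `z₀` at which `h` has degree `d`, the image of `D_3 u` under `h` is `d` times
Lebesgue measure. -/
theorem exists_graphImage_eq_mul_volume {Ω : Set R3} (hΩ : IsOpen Ω) {u : R3 → ℝ}
    (hu : ContinuousOn u Ω) {μ : SignedMeasure R3} (hμ : IsDistribPartial Ω u 2 μ)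
    {U : Set R3} (hU : IsOpen U) (hUne : U.Nonempty) (hUc : IsCompact (closure U))
    (hUΩ : closure U ⊆ Ω) {z₀ : R3} {d : ℤ} (hd : IsBrouwerDegree (graphMap u) U z₀ d) :
    ∃ r > 0, ∀ A, MeasurableSet A → A ⊆ Metric.ball z₀ r →
      graphImage μ U u A = d * volume.real A := by
  obtain ⟨r, hr, hint⟩ := exists_vectorIntegral_comp_graphMap_eq hΩ hu hμ hU hUne hUc hUΩ hd
  refine ⟨r, hr, ?_⟩
  have huU : ContinuousOn u U := hu.mono (subset_closure.trans hUΩ)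
  set B := Metric.ball z₀ r
  have hBo : IsOpen B := Metric.isOpen_ball
  have hBfin : IsFiniteMeasure (volume.restrict B) :=
    ⟨by simpa using Metric.isBounded_ball.measure_lt_top⟩
  have hopen : ∀ V, IsOpen V → V ⊆ B → graphImage μ U u V = d * volume.real V := by
    intro V hV hVB
    obtain ⟨f, hf, hf1, hfz, hflim⟩ := exists_contDiff_tendsto_indicator hV
    have h1 := vectorIntegral_indicator_comp_tendsto (μ := μ) hU.measurableSet huU hV.measurableSet
      (fun k => (hf k).continuous) hf1 hflim
    simp only [hint _ (hf _) fun z hz => hfz _ z fun h => hz (hVB h)] at h1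
    refine tendsto_nhds_unique h1 (Tendsto.const_mul _ ?_)
    rw [← integral_indicator_one hV.measurableSet]
    refine tendsto_integral_filter_of_dominated_convergence (B.indicator fun _ => 1) ?_ ?_ ?_ ?_
    · exact Eventually.of_forall fun k => (hf k).continuous.aestronglyMeasurable
    · refine Eventually.of_forall fun k => ae_of_all _ fun x => ?_
      by_cases hx : x ∈ B
      · simpa [hx] using hf1 k x
      · simp [hx, hfz k x fun h => hx (hVB h)]
    · exact (integrable_indicator_iff hBo.measurableSet).2
        (integrable_const (1 : ℝ))
    · exact ae_of_all _ hflim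
  -- Open sets form a generating π-system, so agreement on them extends to Borel sets.
  have heq : (graphImage μ U u).restrict B =
      (d : ℝ) • (volume.restrict B).toSignedMeasure := by
    refine VectorMeasure.ext_of_generateFrom _ ?_ (BorelSpace.measurable_eq (α := R3))
      isPiSystem_isOpen ?_
    · intro V hV
      have hVo : IsOpen V := hV
      rw [VectorMeasure.restrict_apply _ hBo.measurableSet hVo.measurableSet,
        hopen _ (hVo.inter hBo) inter_subset_right]
      simp [Measure.toSignedMeasure_apply_measurable hVo.measurableSet,
        measureReal_restrict_apply hVo.measurableSet]
    · rw [VectorMeasure.restrict_apply _ hBo.measurableSet MeasurableSet.univ,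
        hopen _ (isOpen_univ.inter hBo) inter_subset_right]
      simp [Measure.toSignedMeasure_apply_measurable MeasurableSet.univ,
        measureReal_restrict_apply MeasurableSet.univ]
  intro A hA hAB
  have h : (graphImage μ U u).restrict B A = ((d : ℝ) • (volume.restrict B).toSignedMeasure) A := by
    rw [heq]
  rw [VectorMeasure.restrict_apply _ hBo.measurableSet hA,
    inter_eq_left.2 hAB] at h
  simpa [Measure.toSignedMeasure_apply_measurable hA, measureReal_restrict_apply hA,
    inter_eq_left.2 hAB] using h

/-- A function that is locally the density of a signed measure `ν` on a conull open set is
integrable, and its integral is the mass of that set. -/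
lemma integrable_of_local_density {ν : SignedMeasure R3} {W : Set R3}
    (hWn : volume Wᶜ = 0) {D : R3 → ℝ} (hW : IsOpen W)
    (hD : ∀ z ∈ W, ∃ r > 0, ∀ A, MeasurableSet A → A ⊆ Metric.ball z r →
      ν A = D z * volume.real A) :
    Integrable D ∧ ∫ z, D z = ν W := by
  have hD' : ∀ z ∈ W, ∃ r > 0, Metric.ball z r ⊆ W ∧ ∀ A, MeasurableSet A → A ⊆ Metric.ball z r →
      ν A = D z * volume.real A := by
    intro z hz
    obtain ⟨r₁, hr₁, h₁⟩ := Metric.isOpen_iff.1 hW z hz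
    obtain ⟨r₂, hr₂, h₂⟩ := hD z hz
    exact ⟨min r₁ r₂, lt_min hr₁ hr₂, (Metric.ball_subset_ball (min_le_left _ _)).trans h₁,
      fun A hA hAr => h₂ A hA (hAr.trans (Metric.ball_subset_ball (min_le_right _ _)))⟩
  choose! r hr hrW hrν using hD'
  -- Both densities describe `ν` on a small ball of positive volume about `z'`, so they coincide.
  have hconst : ∀ z ∈ W, ∀ z' ∈ Metric.ball z (r z), D z' = D z := by
    intro z hz z' hz'
    have hz'W := hrW z hz hz'
    obtain ⟨s, hs, hsub⟩ := Metric.isOpen_iff.1 (Metric.isOpen_ball.inter Metric.isOpen_ball) z'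
      ⟨hz', Metric.mem_ball_self (hr z' hz'W)⟩
    have h1 := hrν z hz _ Metric.isOpen_ball.measurableSet (hsub.trans inter_subset_left)
    have h2 := hrν z' hz'W _ Metric.isOpen_ball.measurableSet (hsub.trans inter_subset_right)
    have hpos : 0 < volume.real (Metric.ball z' s) := ENNReal.toReal_pos
      (Metric.measure_ball_pos volume z' hs).ne' Metric.isBounded_ball.measure_lt_top.ne
    exact mul_right_cancel₀ hpos.ne' (h2.symm.trans h1)
  have hWne : W.Nonempty := by
    by_contra h
    rw [not_nonempty_iff_eq_empty] at h
    simp [h] at hWn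
  obtain ⟨t, htW, htc, hcover⟩ := TopologicalSpace.countable_cover_nhdsWithin
    (f := fun z => Metric.ball z (r z)) (s := W)
    fun z hz => mem_nhdsWithin_of_mem_nhds (Metric.ball_mem_nhds z (hr z hz))
  have htne : t.Nonempty := by
    by_contra h
    rw [not_nonempty_iff_eq_empty] at h
    obtain ⟨z, hz⟩ := hWne
    simpa [h] using hcover hz
  obtain ⟨c, rfl⟩ := htc.exists_eq_range htne
  have hcW : ∀ i, c i ∈ W := fun i => htW ⟨i, rfl⟩
  set B : ℕ → Set R3 := fun i => Metric.ball (c i) (r (c i)) with hB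
  set A := disjointed B with hA
  have hAB : ∀ i, A i ⊆ B i := fun i => disjointed_subset B i
  have hAm : ∀ i, MeasurableSet (A i) :=
    fun i => MeasurableSet.disjointed (fun j => Metric.isOpen_ball.measurableSet) i
  have hAd : Pairwise (Function.onFun Disjoint A) := disjoint_disjointed B
  have hAW : ⋃ i, A i = W := by
    rw [hA, iUnion_disjointed]
    refine subset_antisymm (iUnion_subset fun i => hrW _ (hcW i)) ?_
    simpa using hcover
  have hAfin : ∀ i, volume (A i) < ⊤ := fun i =>
    (measure_mono (hAB i)).trans_lt Metric.isBounded_ball.measure_lt_top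
  have hDA : ∀ i, EqOn D (fun _ => D (c i)) (A i) := fun i z hz =>
    hconst _ (hcW i) z (hAB i hz)
  have hνA : ∀ i, ν (A i) = D (c i) * volume.real (A i) := fun i =>
    hrν _ (hcW i) _ (hAm i) (hAB i)
  have hintA : ∀ i, ∫ z in A i, D z = ν (A i) := fun i => by
    rw [setIntegral_congr_fun (hAm i) (hDA i), hνA i]
    simp [mul_comm]
  have hsum : HasSum (fun i => ν (A i)) (ν W) := hAW ▸ ν.m_iUnion hAm hAd
  have hIA : ∀ i, IntegrableOn D (A i) := fun i =>
    (integrableOn_const (hAfin i).ne).congr_fun (fun z hz => (hDA i hz).symm) (hAm i)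
  have hIW : IntegrableOn D W := by
    rw [← hAW]
    refine integrableOn_iUnion_of_summable_integral_norm hIA ?_
    -- The integral of `|D|` over `A i` is `|ν (A i)|`, and the series of the `ν (A i)` converges
    -- absolutely.
    refine hsum.summable.abs.congr fun i => ?_
    rw [setIntegral_congr_fun (g := fun _ => ‖D (c i)‖) (hAm i) fun z hz => by
      simp only [hDA i hz], hνA i, abs_mul, abs_of_nonneg measureReal_nonneg]
    simp [mul_comm]
  have hres : volume.restrict W = (volume : Measure R3) :=
    Measure.restrict_eq_self_of_ae_mem (by rwa [ae_iff])
  constructor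
  · rwa [IntegrableOn, hres] at hIW
  · have h1 := hasSum_integral_iUnion hAm hAd (by rwa [hAW] : IntegrableOn D (⋃ i, A i))
    simp only [hintA] at h1
    rw [hAW, hres] at h1
    exact h1.unique hsum

theorem theorem5p3 (Ω : Set (EuclideanSpace ℝ (Fin 3))) (hΩ : IsOpen Ω)
    (u : EuclideanSpace ℝ (Fin 3) → ℝ) (hu : ContinuousOn u Ω) (hBV : MemBV Ω u)
    (U : Set (EuclideanSpace ℝ (Fin 3))) (hU : IsOpen U)
    (hUc : IsCompact (closure U)) (hUΩ : closure U ⊆ Ω)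
    (hnull : volume (graphMap u '' frontier U) = 0) :
    Integrable (fun z : EuclideanSpace ℝ (Fin 3) => (brouwerDegree (graphMap u) U z : ℝ)) volume ∧
      ∫ z : EuclideanSpace ℝ (Fin 3), (brouwerDegree (graphMap u) U z : ℝ) =
        bvPartial Ω u 2 U := by
  have hex := hBV.exists_partial 2
  obtain ⟨μ, hμ, hbv⟩ : ∃ μ : SignedMeasure R3, IsDistribPartial Ω u 2 μ ∧
      bvPartial Ω u 2 U = μ U := by
    refine ⟨hex.choose, hex.choose_spec, ?_⟩
    rw [bvPartial, dif_pos hex, VectorMeasure.restrict_apply _ hΩ.measurableSet hU.measurableSet,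
      inter_eq_left.2 (subset_closure.trans hUΩ)]
  rw [hbv]
  -- For empty `U` every degree is an empty sum, and both sides vanish.
  rcases U.eq_empty_or_nonempty with rfl | hUne
  · have hzero : ∀ z, brouwerDegree (graphMap u) ∅ z = 0 := by
      intro z
      rw [brouwerDegree]
      split_ifs with h
      · obtain ⟨g, -, -, -, hg⟩ := h.choose_spec
        rw [← hg]
        simp [regularDegree]
      · rfl
    simp [hzero]
  set N := graphMap u '' frontier U with hN
  have hNc : IsClosed N :=
    ((hUc.of_isClosed_subset isClosed_frontier frontier_subset_closure).image_of_continuousOn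
      ((continuousOn_graphMap hu).mono (frontier_subset_closure.trans hUΩ))).isClosed
  have huU : ContinuousOn u U := hu.mono (subset_closure.trans hUΩ)
  -- Whatever integer the definition of the degree picks is the density of the image measure, so no
  -- separate uniqueness of the degree is needed.
  have hdens : ∀ z ∈ Nᶜ, ∃ r > 0, ∀ A, MeasurableSet A → A ⊆ Metric.ball z r →
      graphImage μ U u A = (brouwerDegree (graphMap u) U z : ℝ) * volume.real A := by
    intro z hz
    have h := exists_isBrouwerDegree_graphMap hΩ hu hμ hUne hUc hUΩ hz
    rw [brouwerDegree, dif_pos h]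
    exact exists_graphImage_eq_mul_volume hΩ hu hμ hU hUne hUc hUΩ h.choose_spec
  have hmain := integrable_of_local_density (by rwa [compl_compl]) hNc.isOpen_compl hdens
  refine ⟨hmain.1, hmain.2.trans ?_⟩
  have h0 : graphImage μ U u N = 0 := by
    rw [graphImage_apply hU.measurableSet huU hNc.measurableSet]
    exact apply_inter_preimage_graphMap_eq_zero hΩ hu hμ hU hUc hUΩ hNc hnull
  rw [VectorMeasure.of_compl hNc.measurableSet, h0, sub_zero,
    graphImage_apply hU.measurableSet huU MeasurableSet.univ]
  simp
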